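/- **Setting.** For a bounded open set $\Omega\subset\mathbb R^d$, let $H^1(\Omega)$ be the space of all $u\in L^2(\Omega)$ whose weak gradient is in $L^2(\Omega)^d$, normed by $\|u\|^2=\|u\|_{L^2}^2+\|\nabla u\|_{L^2}^2$, and let $\widetilde H^1(\Omega)$ be the closure in $H^1(\Omega)$ of $H^1(\Omega)\cap C^0(\overline\Omega)$. For a unit vector $\theta$ and $x\in\Omega$, let $\Phi_\theta(x)=x+\delta_\theta(x)\theta$ with $\delta_\theta(x)=\sup\{s\ge 0: x+t\theta\in\Omega\ \forall t\in[0,s)\}$, and let $\mu_\theta$ be the measure on $\partial\Omega$ given by $\mu_\theta(A)=|\{x\in\Omega:\Phi_\theta(x)\in A\}|$. Let $P_\theta(x)=x-(x\cdot\theta)\theta$ and $\omega_\theta(y)=\{s\in\mathbb R:s\theta+y\in\Omega\}$. A function $g:\partial\Omega\to\mathbb R$ is a *directional trace* of $u\in H^1(\Omega)$ in the direction $\theta$ if, for some representative of $u$ and for all $y\in P_\theta(\Omega)$ outside a set of $(d-1)$-dimensional Lebesgue measure zero, the function $s\mapsto u(s\theta+y)$ belongs to $H^1(\omega_\theta(y))$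 and, for each maximal interval $(\alpha,\beta)$ of $\omega_\theta(y)$, it agrees a.e. on $(\alpha,\beta)$ with a function that is continuous on $(\alpha,\beta]$ and has the value $g(\beta\theta+y)$ at $\beta$. The space $H^1_{\rm tr}(\Omega)$ consists of all $u\in H^1(\Omega)$ for which there is a function $g:\partial\Omega\to\mathbb R$ such that $g\in L^2(\partial\Omega,\mu_\theta)$ for all unit vectors $\theta$, with norms bounded independently of $\theta$, and such that, for every unit vector $\theta$, $g$ is $\mu_\theta$-a.e. equal to a directional trace of $u$ in the direction $\theta$. **Domain.** Let $\mathcal C\subset[0,1]$ be the middle-third Cantor set, $K_a=\{(x_1,x_2): 0<x_2<1,\ |x_1-a|<x_2\}$, $\Omega_{\mathcal C}=\bigcup_{a\in\mathcal C}K_a$, $\psi(x_1,x_2)=(x_1,-x_2)$ and $\Omega=\Omega_{\mathcal C}\cup\psi(\Omega_{\mathcal C})\subset\mathbb R^2$. For $n\in\mathbb N$ let $y_n=3^{-n}/2$ and $\mathcal D_n=\{x\in\mathbb R:(x,y_n)\in\Omega_{\mathcal C}\}$. **Statement.** The set $\Omega$ is open and bounded. The function $\widehat u$ that is equal to $1$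 on $\Omega_{\mathcal C}$ and to $-1$ on $\psi(\Omega_{\mathcal C})$ belongs to $H^1_{\rm tr}(\Omega)\setminus\widetilde H^1(\Omega)$; in particular, this set is not empty. Moreover, every $v\in H^1(\Omega)$ has a trace on each set $\mathcal D_n\times\{y_n\}$ (for a.e. $x\in\mathcal D_n$, the value at $y_n$ of the representative of $y\mapsto v(x,y)$ that is continuous near $y_n$), this trace is integrable, and the averages $\nu_n(v)=\frac1{|\mathcal D_n|}\int_{\mathcal D_n}v(x,y_n)\,dx$ define continuous linear forms $\nu_n$ on $H^1(\Omega)$ that converge, in the norm of the dual space $H^1(\Omega)'$, to some $\overline\nu\in H^1(\Omega)'$. For every $v\in H^1(\Omega)$ one has $v\circ\psi\in H^1(\Omega)$, and $\overline\nu_\psi(v)=\overline\nu(v\circ\psi)$ defines a continuous linear form $\overline\nu_\psi$ on $H^1(\Omega)$. The continuous linear form $\overline\nu-\overline\nu_\psi$ vanishes on $\widetilde H^1(\Omega)$, and $(\overline\nu-\overline\nu_\psi)(\widehat u)=2$. -/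

import Mathlib

open Set Filter Topology MeasureTheory
open scoped ContDiff RealInnerProductSpace

noncomputable section

/-! ## Weak gradients and the Sobolev space `H¹(Ω)` -/

/-- Test functions: the elements of `C_c^∞(Ω)`. -/
def IsTestFunction {E : Type*} [NormedAddCommGroup E] [InnerProductSpace ℝ E]
    (Ω : Set E) (φ : E → ℝ) : Prop :=
  ContDiff ℝ ∞ φ ∧ HasCompactSupport φ ∧ tsupport φ ⊆ Ω

/-- `g` is the gradient of `u` on `Ω` in the sense of distributions: for every vector `v`,
`∫_Ω u ∂_v φ = - ∫_Ω ⟨g, v⟩ φ` for all test functions `φ`. -/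
def IsWeakGradient {E : Type*} [NormedAddCommGroup E] [InnerProductSpace ℝ E] [MeasureSpace E]
    (Ω : Set E) (u : E → ℝ) (g : E → E) : Prop :=
  ∀ φ : E → ℝ, IsTestFunction Ω φ → ∀ v : E,
    ∫ x in Ω, u x * fderiv ℝ φ x v = - ∫ x in Ω, ⟪g x, v⟫ * φ x

/-- The function `u` belongs to `H¹(Ω)`: it is in `L²(Ω)` and has a weak gradient in `L²(Ω)`. -/
def MemH1 {E : Type*} [NormedAddCommGroup E] [InnerProductSpace ℝ E] [MeasureSpace E]
    (Ω : Set E) (u : E → ℝ) : Prop :=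
  MemLp u 2 (volume.restrict Ω) ∧
    ∃ g : E → E, MemLp g 2 (volume.restrict Ω) ∧ IsWeakGradient Ω u g

section Helpers

variable {E : Type*} [NormedAddCommGroup E] [InnerProductSpace ℝ E] [MeasureSpace E]

theorem IsWeakGradient.congr {Ω : Set E} {u u' : E → ℝ} {g g' : E → E}
    (h : IsWeakGradient Ω u g) (hu : u' =ᵐ[volume.restrict Ω] u)
    (hg : g' =ᵐ[volume.restrict Ω] g) : IsWeakGradient Ω u' g' := by
  intro φ hφ v
  have h1 : ∫ x in Ω, u' x * fderiv ℝ φ x v = ∫ x in Ω, u x * fderiv ℝ φ x v :=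
    integral_congr_ae (hu.mono fun x hx => by simp only [hx])
  have h2 : ∫ x in Ω, ⟪g' x, v⟫ * φ x = ∫ x in Ω, ⟪g x, v⟫ * φ x :=
    integral_congr_ae (hg.mono fun x hx => by simp only [hx])
  rw [h1, h2]
  exact h φ hφ v

theorem IsWeakGradient.zero (Ω : Set E) :
    IsWeakGradient Ω (fun _ => (0 : ℝ)) (fun _ => (0 : E)) := by
  intro φ _ v
  simp

theorem IsWeakGradient.const_smul {Ω : Set E} {u : E → ℝ} {g : E → E}
    (h : IsWeakGradient Ω u g) (c : ℝ) :
    IsWeakGradient Ω (fun x => c * u x) (fun x => c • g x) := by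
  intro φ hφ v
  simp only [real_inner_smul_left, mul_assoc, integral_const_mul]
  rw [h φ hφ v, mul_neg]

theorem IsWeakGradient.add [BorelSpace E] [IsFiniteMeasureOnCompacts (volume : Measure E)]
    {Ω : Set E} {u₁ u₂ : E → ℝ} {g₁ g₂ : E → E}
    (hu₁ : MemLp u₁ 2 (volume.restrict Ω)) (hu₂ : MemLp u₂ 2 (volume.restrict Ω))
    (hg₁ : MemLp g₁ 2 (volume.restrict Ω)) (hg₂ : MemLp g₂ 2 (volume.restrict Ω))
    (h₁ : IsWeakGradient Ω u₁ g₁) (h₂ : IsWeakGradient Ω u₂ g₂) :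
    IsWeakGradient Ω (fun x => u₁ x + u₂ x) (fun x => g₁ x + g₂ x) := by
  intro φ hφ v
  have hφ2 : MemLp φ 2 (volume.restrict Ω) :=
    (hφ.1.continuous.memLp_of_hasCompactSupport hφ.2.1).restrict Ω
  have hd2 : MemLp (fun x => fderiv ℝ φ x v) 2 (volume.restrict Ω) :=
    (((hφ.1.continuous_fderiv (by simp)).clm_apply
      continuous_const).memLp_of_hasCompactSupport (hφ.2.1.fderiv_apply ℝ v)).restrict Ω
  simp only [inner_add_left, add_mul]
  have e₁ : ∫ x in Ω, (u₁ x * fderiv ℝ φ x v + u₂ x * fderiv ℝ φ x v) = _ :=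
    integral_add (hu₁.integrable_mul hd2) (hu₂.integrable_mul hd2)
  have e₂ : ∫ x in Ω, (⟪g₁ x, v⟫ * φ x + ⟪g₂ x, v⟫ * φ x) = _ :=
    integral_add ((hg₁.inner_const v).integrable_mul hφ2)
      ((hg₂.inner_const v).integrable_mul hφ2)
  refine e₁.trans (Eq.trans ?_ (congrArg Neg.neg e₂).symm)
  exact (congrArg₂ (· + ·) (h₁ φ hφ v) (h₂ φ hφ v)).trans (neg_add _ _).symm

end Helpers

variable {d : ℕ}

/-- The Hilbert space `H¹(Ω)`, realised as the space of the pairs `(u, ∇u)` in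
`L²(Ω) × L²(Ω)^d` (for `Ω` open, `∇u` is determined by `u`). The norm is
`‖u‖² = ‖u‖_{L²}² + ‖∇u‖_{L²}²`. -/
def H1 (Ω : Set (EuclideanSpace ℝ (Fin d))) :
    Submodule ℝ (WithLp 2 (Lp ℝ 2 (volume.restrict Ω) ×
      Lp (EuclideanSpace ℝ (Fin d)) 2 (volume.restrict Ω))) where
  carrier := {p | IsWeakGradient Ω p.fst p.snd}
  zero_mem' := (IsWeakGradient.zero Ω).congr (Lp.coeFn_zero _ _ _) (Lp.coeFn_zero _ _ _)
  add_mem' := fun {p q} hp hq =>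
    (IsWeakGradient.add (Lp.memLp p.fst) (Lp.memLp q.fst) (Lp.memLp p.snd) (Lp.memLp q.snd)
      hp hq).congr (Lp.coeFn_add _ _) (Lp.coeFn_add _ _)
  smul_mem' := fun c p hp =>
    (IsWeakGradient.const_smul (u := p.fst) (g := p.snd) hp c).congr
      (Lp.coeFn_smul c p.fst) (Lp.coeFn_smul c p.snd)

/-- A representative of `u ∈ H¹(Ω)`; only its values almost everywhere in `Ω` are meaningful. -/
def h1Rep {Ω : Set (EuclideanSpace ℝ (Fin d))} (u : H1 Ω) : EuclideanSpace ℝ (Fin d) → ℝ :=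
  u.1.fst

/-- `H̃¹(Ω)`: the closure in `H¹(Ω)` of `H¹(Ω) ∩ C⁰(closure Ω)`. -/
def H1tilde (Ω : Set (EuclideanSpace ℝ (Fin d))) : Set (H1 Ω) :=
  closure {u | ∃ f : EuclideanSpace ℝ (Fin d) → ℝ,
    ContinuousOn f (closure Ω) ∧ h1Rep u =ᵐ[volume.restrict Ω] f}

/-! ## Directional measures, directional traces and omnidirectional traces -/

/-- `δ_θ(x) = sup {s ≥ 0 : x + tθ ∈ Ω for all t ∈ [0, s)}`. -/
def exitTime (Ω : Set (EuclideanSpace ℝ (Fin d))) (θ x : EuclideanSpace ℝ (Fin d)) : ℝ :=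
  sSup {s : ℝ | 0 ≤ s ∧ ∀ t ∈ Ico 0 s, x + t • θ ∈ Ω}

/-- `Φ_θ(x) = x + δ_θ(x) θ`, the boundary point that `x ∈ Ω` sees in the direction `θ`. -/
def exitPoint (Ω : Set (EuclideanSpace ℝ (Fin d))) (θ x : EuclideanSpace ℝ (Fin d)) :
    EuclideanSpace ℝ (Fin d) :=
  x + exitTime Ω θ x • θ

/-- The directional measure `μ_θ(A) = |{x ∈ Ω : Φ_θ(x) ∈ A}|`, regarded as a measure on the whole
space that is carried by `∂Ω`. -/
def directionalMeasure (Ω : Set (EuclideanSpace ℝ (Fin d))) (θ : EuclideanSpace ℝ (Fin d)) :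
    Measure (EuclideanSpace ℝ (Fin d)) :=
  (volume.restrict Ω).map (exitPoint Ω θ)

/-- `P_θ(x) = x - (x · θ) θ`, the orthogonal projection on the hyperplane orthogonal to the unit
vector `θ`. -/
def hyperplaneProj (θ x : EuclideanSpace ℝ (Fin d)) : EuclideanSpace ℝ (Fin d) :=
  x - ⟪x, θ⟫ • θ

/-- `ω_θ(y) = {s : sθ + y ∈ Ω}`. -/
def lineSection (Ω : Set (EuclideanSpace ℝ (Fin d))) (θ y : EuclideanSpace ℝ (Fin d)) : Set ℝ :=
  {s | s • θ + y ∈ Ω}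

/-- `g` is a directional trace of `u` on `∂Ω` in the direction `θ` (only the values of `g` on `∂Ω`
are used): for a representative `u'` of `u` and for almost all `y ∈ P_θ(Ω)`, the function
`s ↦ u'(sθ + y)` belongs to `H¹(ω_θ(y))`, and at the right end `β` of each of the maximal intervals
`(α, β)` of `ω_θ(y)` the value of `g` is that of its representative `f` which is continuous on
`(α, β]`. Negligibility with respect to the `(d-1)`-dimensional Lebesgue measure of the hyperplane
orthogonal to `θ` is expressed by the `(d-1)`-dimensional Hausdorff measure. -/
def IsDirectionalTrace (Ω : Set (EuclideanSpace ℝ (Fin d))) (θ : EuclideanSpace ℝ (Fin d))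
    (u g : EuclideanSpace ℝ (Fin d) → ℝ) : Prop :=
  ∃ u' : EuclideanSpace ℝ (Fin d) → ℝ, u' =ᵐ[volume.restrict Ω] u ∧
    ∃ A ⊆ hyperplaneProj θ '' Ω,
      Measure.hausdorffMeasure ((d : ℝ) - 1) ((hyperplaneProj θ '' Ω) \ A) = 0 ∧
      ∀ y ∈ A, MemH1 (lineSection Ω θ y) (fun s : ℝ => u' (s • θ + y)) ∧
        ∀ α β : ℝ, α < β → Ioo α β ⊆ lineSection Ω θ y → α ∉ lineSection Ω θ y →
          β ∉ lineSection Ω θ y →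
          ∃ f : ℝ → ℝ, ContinuousOn f (Ioc α β) ∧
            (∀ᵐ s ∂volume.restrict (Ioo α β), f s = u' (s • θ + y)) ∧
            g (β • θ + y) = f β

/-- The functions on `∂Ω` that belong to `L²(∂Ω, μ_θ)` for all unit vectors `θ`, with a norm
bounded independently of `θ`. -/
def MemL2Directional (Ω : Set (EuclideanSpace ℝ (Fin d))) (g : EuclideanSpace ℝ (Fin d) → ℝ) :
    Prop :=
  ∃ M : ℝ, ∀ θ ∈ Metric.sphere (0 : EuclideanSpace ℝ (Fin d)) 1,
    MemLp g 2 (directionalMeasure Ω θ) ∧ ∫ z, g z ^ 2 ∂(directionalMeasure Ω θ) ≤ M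

/-- `g` is an omnidirectional trace of `u`: for every direction `θ`, the directional trace
of `u` is equal to `g` almost everywhere for `μ_θ`. -/
def IsOmnidirectionalTrace (Ω : Set (EuclideanSpace ℝ (Fin d)))
    (u g : EuclideanSpace ℝ (Fin d) → ℝ) : Prop :=
  MemL2Directional Ω g ∧
    ∀ θ ∈ Metric.sphere (0 : EuclideanSpace ℝ (Fin d)) 1,
      ∃ γ : EuclideanSpace ℝ (Fin d) → ℝ,
        IsDirectionalTrace Ω θ u γ ∧ γ =ᵐ[directionalMeasure Ω θ] g

/-- `H¹_tr(Ω)`: the elements of `H¹(Ω)` that have an omnidirectional trace on `∂Ω`. -/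
def H1tr (Ω : Set (EuclideanSpace ℝ (Fin d))) : Set (H1 Ω) :=
  {u | ∃ g : EuclideanSpace ℝ (Fin d) → ℝ, IsOmnidirectionalTrace Ω (h1Rep u) g}

/-! ## The domain -/

/-- The cone `K_a` with vertex `(a, 0)`, angle `π/2` and height `1`. -/
def cone (a : ℝ) : Set (EuclideanSpace ℝ (Fin 2)) :=
  {x | 0 < x 1 ∧ x 1 < 1 ∧ |x 0 - a| < x 1}

/-- The union of the cones whose vertices are the points of the middle-third Cantor set. -/
def monoconeDomain : Set (EuclideanSpace ℝ (Fin 2)) :=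
  ⋃ a ∈ cantorSet, cone a

/-- The symmetry `ψ(x, y) = (x, -y)`. -/
def reflect (x : EuclideanSpace ℝ (Fin 2)) : EuclideanSpace ℝ (Fin 2) :=
  !₂[x 0, -x 1]

/-- The union of the cones over the Cantor set and of their mirror images. -/
def biconeDomain : Set (EuclideanSpace ℝ (Fin 2)) :=
  monoconeDomain ∪ reflect '' monoconeDomain

/-! ## Averages over horizontal lines -/

/-- The height `y_n = 3^{-n} / 2`. -/
def lineHeight (n : ℕ) : ℝ := (3 : ℝ)⁻¹ ^ n / 2

/-- `D_n = {x : (x, y_n) ∈ Ω_C}`. -/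
def lineDomain (n : ℕ) : Set ℝ := {x | !₂[x, lineHeight n] ∈ monoconeDomain}

/-- `t` is the trace of `u` on `D × {c}`: for almost all `x ∈ D`, the continuous representative
near `c` of `y ↦ u(x, y)` takes at `c` the value `t x`, that is, `t x` is the essential limit
of `u(x, y)` as `y → c`. -/
def IsHorizontalTrace (u : EuclideanSpace ℝ (Fin 2) → ℝ) (c : ℝ) (D : Set ℝ) (t : ℝ → ℝ) : Prop :=
  ∀ᵐ x ∂volume.restrict D, Tendsto (fun y : ℝ => u !₂[x, y]) (𝓝 c ⊓ ae volume) (𝓝 (t x))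

/-- `L` is the linear form `u ↦ |D|⁻¹ ∫_D u(x, c) dx` on `H¹(Ω)`: each `u` has a trace on
`D × {c}`, integrable over `D`, and `L u` is the average of this trace. -/
def IsHorizontalAverage (Ω : Set (EuclideanSpace ℝ (Fin 2))) (c : ℝ) (D : Set ℝ)
    (L : H1 Ω →L[ℝ] ℝ) : Prop :=
  ∀ u : H1 Ω, ∃ t : ℝ → ℝ, IsHorizontalTrace (h1Rep u) c D t ∧ IntegrableOn t D ∧
    L u = (volume.real D)⁻¹ * ∫ x in D, t x

end

noncomputable section

/-! ## Geometry of the domain -/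

/-! The two halves of Ω can meet only along the Cantor set on the axis. This set is Lebesgue null,
so in every direction almost every line avoids it; no directional trace notices the jump of û there.
It is nevertheless large enough for averages taken near it to be controlled by the H¹ norm, so that
agreement of the two sides is a constraint which survives the closure in H¹.

The control is a geometric estimate for consecutive averages, `abs_lineForm_sub_succ_le`. The values
on D_n × {y_n} and on D_{n+1} × {y_{n+1}} are both transported vertically to a common height y in
(y_n, 2y_n), at the cost of the integral of |∂₂v| over a thin product set divided by the measure of
the base (`abs_heightTraceAverage_sub_lineAverage_le`). At the height y, the averages over D_n and
D_{n+1} are compared through self-similarity: D_{n+1} is the disjoint union of two copies of D_n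
shrunk by 3, and D_0 is an interval, so the difference is at most 2 · 2⁻ⁿ ∫_{D_n} |∂₁v|
(`abs_lineAverage_sub_succ_le`). Averaging over y and applying Cauchy–Schwarz, the factor (3/2)ⁿ
from 1/|D_n| meets (√2/3)ⁿ, the square root of the area of D_n × (y_n, 2y_n). The product (√2/2)ⁿ is
summable, hence the forms converge in norm.

For a function continuous on the compact closure of Ω, uniform continuity makes the averages at
heights y_n and -y_n have the same limit (`tendsto_lineAverage_sub_of_continuousOn`). By continuity
of the forms this passes to the closure H̃¹, whereas û gives 1 and -1.

Weak derivatives are turned into absolute continuity on almost every line by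
`ae_exists_ae_eq_primitive`. An averaged formula for the trace, `integral_affine_weight_eq`, makes
it measurable in x and exhibits its mean as an L² pairing with (v, ∇v). The omnidirectional trace of
û is obtained in `isDirectionalTrace_heightSign`. -/

lemma cantor_div_three {x : ℝ} (hx : x ∈ cantorSet) : x / 3 ∈ cantorSet := by
  rw [cantorSet_eq_union_halves]; exact Or.inl ⟨x, hx, rfl⟩

lemma cantor_two_add_div_three {x : ℝ} (hx : x ∈ cantorSet) : (2 + x) / 3 ∈ cantorSet := by
  rw [cantorSet_eq_union_halves]; exact Or.inr ⟨x, hx, rfl⟩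

lemma one_mem_cantorSet : (1 : ℝ) ∈ cantorSet := by
  refine mem_iInter.2 fun n => ?_
  induction n with
  | zero => simp
  | succ n ih => exact Or.inr ⟨1, ih, by norm_num⟩

/-- Two copies shrunk by 3 cover the set, so its finite measure is at most 2/3 of itself. -/
lemma volume_cantorSet : volume cantorSet = 0 := by
  have hfin : volume cantorSet ≠ ⊤ :=
    ne_top_of_le_ne_top (by simp) (measure_mono cantorSet_subset_unitInterval)
  have h1 : ((· / 3) '' cantorSet : Set ℝ) = (fun x => (1 / 3 : ℝ) • x) '' cantorSet := by
    congr 1; ext x; simp; ring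
  have h2 : ((fun x : ℝ => (2 + x) / 3) '' cantorSet : Set ℝ)
      = (fun x : ℝ => 2 / 3 + x) '' ((fun x => (1 / 3 : ℝ) • x) '' cantorSet) := by
    rw [image_image]; congr 1; ext x; simp; ring
  have hv : volume ((fun x => (1 / 3 : ℝ) • x) '' cantorSet)
      = ENNReal.ofReal (1 / 3) * volume cantorSet := by
    have := Measure.addHaar_smul (volume : Measure ℝ) (1 / 3 : ℝ) cantorSet
    rw [← image_smul] at this
    simpa using this
  have key : volume cantorSet ≤ ENNReal.ofReal (2 / 3) * volume cantorSet := by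
    conv_lhs => rw [cantorSet_eq_union_halves]
    refine (measure_union_le _ _).trans ?_
    rw [h2, h1, image_add_left, measure_preimage_add, hv, ← add_mul,
      ← ENNReal.ofReal_add (by norm_num) (by norm_num)]
    norm_num
  by_contra hne
  have hlt : ENNReal.ofReal (2 / 3) * volume cantorSet < 1 * volume cantorSet :=
    ENNReal.mul_lt_mul_left hne hfin (by
      rw [← ENNReal.ofReal_one]; exact (ENNReal.ofReal_lt_ofReal_iff (by norm_num)).2 (by norm_num))
  rw [one_mul] at hlt
  exact absurd key (not_le.2 hlt)

lemma isOpen_cone (a : ℝ) : IsOpen (cone a) := by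
  have h0 : IsOpen {x : EuclideanSpace ℝ (Fin 2) | 0 < x 1} := isOpen_lt (by fun_prop) (by fun_prop)
  have h1 : IsOpen {x : EuclideanSpace ℝ (Fin 2) | x 1 < 1} := isOpen_lt (by fun_prop) (by fun_prop)
  have h2 : IsOpen {x : EuclideanSpace ℝ (Fin 2) | |x 0 - a| < x 1} :=
    isOpen_lt (by fun_prop) (by fun_prop)
  exact h0.inter (h1.inter h2)

lemma isOpen_monoconeDomain : IsOpen monoconeDomain :=
  isOpen_biUnion fun a _ => isOpen_cone a

lemma mem_monoconeDomain {x : EuclideanSpace ℝ (Fin 2)} :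
    x ∈ monoconeDomain ↔ 0 < x 1 ∧ x 1 < 1 ∧ ∃ a ∈ cantorSet, |x 0 - a| < x 1 := by
  simp only [monoconeDomain, mem_iUnion, cone, mem_ofPred_eq, exists_prop]
  grind

@[simp] lemma reflect_zero (x : EuclideanSpace ℝ (Fin 2)) : reflect x 0 = x 0 := by simp [reflect]

@[simp] lemma reflect_one (x : EuclideanSpace ℝ (Fin 2)) : reflect x 1 = -x 1 := by simp [reflect]

lemma reflect_reflect (x : EuclideanSpace ℝ (Fin 2)) : reflect (reflect x) = x := by
  ext i; fin_cases i <;> simp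

lemma reflect_image (s : Set (EuclideanSpace ℝ (Fin 2))) : reflect '' s = reflect ⁻¹' s :=
  congrFun (image_eq_preimage_of_inverse reflect_reflect reflect_reflect) s

lemma mem_biconeDomain {x : EuclideanSpace ℝ (Fin 2)} :
    x ∈ biconeDomain ↔ 0 < |x 1| ∧ |x 1| < 1 ∧ ∃ a ∈ cantorSet, |x 0 - a| < |x 1| := by
  rw [biconeDomain, reflect_image, mem_union, mem_preimage, mem_monoconeDomain,
    mem_monoconeDomain, reflect_zero, reflect_one]
  constructor
  · rintro (⟨h1, h2, h3⟩ | ⟨h1, h2, h3⟩)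
    · rw [abs_of_pos h1]; exact ⟨h1, h2, h3⟩
    · rw [abs_of_neg (by linarith)]; exact ⟨h1, h2, h3⟩
  · rintro ⟨h1, h2, h3⟩
    rcases le_or_gt 0 (x 1) with h | h
    · rw [abs_of_nonneg h] at *; exact Or.inl ⟨h1, h2, h3⟩
    · rw [abs_of_neg h] at *; exact Or.inr ⟨h1, h2, h3⟩

lemma continuous_reflect : Continuous reflect := by
  unfold reflect
  refine (PiLp.continuous_toLp 2 _).comp (continuous_pi fun i => ?_)
  fin_cases i <;> simp <;> fun_prop

lemma isOpen_biconeDomain : IsOpen biconeDomain := by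
  rw [biconeDomain, reflect_image]
  exact isOpen_monoconeDomain.union (isOpen_monoconeDomain.preimage continuous_reflect)

lemma isBounded_biconeDomain : Bornology.IsBounded biconeDomain := by
  refine isBounded_iff_forall_norm_le.2 ⟨3, fun x hx => ?_⟩
  obtain ⟨_, h2, a, ha, h3⟩ := mem_biconeDomain.1 hx
  have ha' := cantorSet_subset_unitInterval ha
  have h4 : |x 0| ≤ 2 := by
    have : |x 0| ≤ |x 0 - a| + |a| := by simpa using abs_add_le (x 0 - a) a
    have : |a| ≤ 1 := abs_le.2 ⟨by linarith [ha'.1], ha'.2⟩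
    linarith
  rw [EuclideanSpace.norm_eq, Real.sqrt_le_left (by norm_num)]
  simp only [Fin.sum_univ_two, Real.norm_eq_abs]
  nlinarith [abs_nonneg (x 0), abs_nonneg (x 1)]

lemma lineHeight_pos (n : ℕ) : 0 < lineHeight n := by unfold lineHeight; positivity

lemma lineHeight_succ (n : ℕ) : lineHeight (n + 1) = lineHeight n / 3 := by
  unfold lineHeight; rw [pow_succ]; ring

lemma lineHeight_le (n : ℕ) : lineHeight n ≤ 1 / 2 := by
  unfold lineHeight
  have : (3 : ℝ)⁻¹ ^ n ≤ 1 := pow_le_one₀ (by norm_num) (by norm_num)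
  linarith

/-- The open neighbourhood of radius `s` of the Cantor set. -/
def cantorThickening (s : ℝ) : Set ℝ := {x | ∃ a ∈ cantorSet, |x - a| < s}

lemma isOpen_cantorThickening (s : ℝ) : IsOpen (cantorThickening s) := by
  have : cantorThickening s = ⋃ a ∈ cantorSet, {x | |x - a| < s} := by
    ext x; simp [cantorThickening]
  rw [this]
  exact isOpen_biUnion fun a _ => isOpen_lt (by fun_prop) (by fun_prop)

lemma lineDomain_eq (n : ℕ) : lineDomain n = cantorThickening (lineHeight n) := by
  ext x
  have := lineHeight_pos n
  have := lineHeight_le n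
  simp only [lineDomain, cantorThickening, mem_ofPred_eq, mem_monoconeDomain]
  constructor
  · rintro ⟨-, -, h⟩
    simpa using h
  · intro h
    exact ⟨by simpa, by simpa using by linarith, by simpa using h⟩

lemma cantorThickening_mono {s t : ℝ} (h : s ≤ t) : cantorThickening s ⊆ cantorThickening t :=
  fun _ ⟨a, ha, hx⟩ => ⟨a, ha, hx.trans_le h⟩

lemma cantorThickening_subset (s : ℝ) : cantorThickening s ⊆ Ioo (-s) (1 + s) := by
  rintro x ⟨a, ha, hx⟩
  have ha' := cantorSet_subset_unitInterval ha
  rw [abs_lt] at hx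
  exact ⟨by linarith [ha'.1], by linarith [ha'.2]⟩

lemma isOpen_lineDomain (n : ℕ) : IsOpen (lineDomain n) := by
  rw [lineDomain_eq]; exact isOpen_cantorThickening _

lemma lineDomain_succ_subset (n : ℕ) : lineDomain (n + 1) ⊆ lineDomain n := by
  rw [lineDomain_eq, lineDomain_eq]
  refine cantorThickening_mono ?_
  rw [lineHeight_succ]; linarith [lineHeight_pos n]

lemma lineDomain_subset (n : ℕ) : lineDomain n ⊆ Ioo (-(1 / 2)) (3 / 2) := by
  rw [lineDomain_eq]
  refine (cantorThickening_subset _).trans (Ioo_subset_Ioo ?_ ?_) <;> linarith [lineHeight_le n]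

lemma lineDomain_zero : lineDomain 0 = Ioo (-(1 / 2)) (3 / 2) := by
  refine (lineDomain_subset 0).antisymm fun x hx => ?_
  rw [lineDomain_eq]
  have h0 : lineHeight 0 = 1 / 2 := by simp [lineHeight]
  rw [h0]
  rcases lt_trichotomy x (1 / 2) with h | h | h
  · exact ⟨0, zero_mem_cantorSet, abs_lt.2 ⟨by linarith [hx.1], by linarith⟩⟩
  -- The midpoint is at distance exactly 1/2 from both 0 and 1, which the strict inequality
  -- excludes; another Cantor point is needed.
  · exact ⟨1 / 3, cantor_div_three one_mem_cantorSet, abs_lt.2 ⟨by linarith, by linarith⟩⟩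
  · exact ⟨1, one_mem_cantorSet, abs_lt.2 ⟨by linarith, by linarith [hx.2]⟩⟩

/-- Dividing the height by 3 matches the contraction ratio of the two maps that generate the Cantor
set. -/
lemma lineDomain_succ (n : ℕ) :
    lineDomain (n + 1) = (fun x => 3 * x) ⁻¹' lineDomain n ∪ (fun x => 3 * x - 2) ⁻¹' lineDomain n := by
  ext x
  simp only [lineDomain_eq, mem_union, mem_preimage, cantorThickening, mem_ofPred_eq,
    lineHeight_succ]
  have e1 (a : ℝ) : |x - a / 3| < lineHeight n / 3 ↔ |3 * x - a| < lineHeight n := by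
    rw [show 3 * x - a = 3 * (x - a / 3) by ring, abs_mul, abs_of_pos (by norm_num : (0 : ℝ) < 3)]
    constructor <;> intro h <;> linarith
  have e2 (a : ℝ) : |x - (2 + a) / 3| < lineHeight n / 3 ↔ |3 * x - 2 - a| < lineHeight n := by
    rw [show 3 * x - 2 - a = 3 * (x - (2 + a) / 3) by ring, abs_mul,
      abs_of_pos (by norm_num : (0 : ℝ) < 3)]
    constructor <;> intro h <;> linarith
  constructor
  · rintro ⟨a, ha, hx⟩
    rw [cantorSet_eq_union_halves] at ha
    rcases ha with ⟨b, hb, rfl⟩ | ⟨b, hb, rfl⟩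
    · exact Or.inl ⟨b, hb, (e1 b).1 hx⟩
    · exact Or.inr ⟨b, hb, (e2 b).1 hx⟩
  · rintro (⟨b, hb, h⟩ | ⟨b, hb, h⟩)
    · exact ⟨_, cantor_div_three hb, (e1 b).2 h⟩
    · exact ⟨_, cantor_two_add_div_three hb, (e2 b).2 h⟩

/-- Since D_n lies in (-1/2, 3/2), a common point would satisfy both 3x < 3/2 and 3x > 3/2. The
bound y_n ≤ 1/2 is just small enough for this. -/
lemma disjoint_lineDomain_preimages (n : ℕ) :
    Disjoint ((fun x => 3 * x) ⁻¹' lineDomain n) ((fun x => 3 * x - 2) ⁻¹' lineDomain n) := by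
  refine disjoint_left.2 fun x h1 h2 => ?_
  have h1' := lineDomain_subset n h1
  have h2' := lineDomain_subset n h2
  linarith [h1'.2, h2'.1]

lemma mem_biconeDomain_of_mem_cantorThickening {x y s : ℝ} (hx : x ∈ cantorThickening s)
    (hs : s ≤ y) (hy : y < 1) : !₂[x, y] ∈ biconeDomain := by
  obtain ⟨a, ha, hxa⟩ := hx
  have hy0 : 0 < y := (abs_nonneg _).trans_lt (hxa.trans_le hs)
  rw [mem_biconeDomain]
  simp only [Matrix.cons_val_zero, Matrix.cons_val_one, Matrix.cons_val_fin_one,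
    abs_of_pos hy0]
  exact ⟨hy0, hy, a, ha, hxa.trans_le hs⟩

/-! ## Averages over the neighbourhoods of the Cantor set -/

lemma preimage_three_mul_sub (b : ℝ) (S : Set ℝ) (F : ℝ → ℝ) :
    ((fun x => 3 * x - 3 * b) ⁻¹' S).indicator F
      = fun x => S.indicator (fun z => F (z / 3 + b)) (3 * x - 3 * b) := by
  ext x
  by_cases hx : 3 * x - 3 * b ∈ S
  · rw [indicator_of_mem (by exact hx), indicator_of_mem hx]; ring_nf
  · rw [indicator_of_notMem (by exact hx), indicator_of_notMem hx]

lemma integrableOn_preimage_three_mul_sub {b : ℝ} {S : Set ℝ} (hS : MeasurableSet S) {F : ℝ → ℝ} :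
    IntegrableOn F ((fun x => 3 * x - 3 * b) ⁻¹' S) ↔ IntegrableOn (fun z => F (z / 3 + b)) S := by
  have hm : MeasurableSet ((fun x : ℝ => 3 * x - 3 * b) ⁻¹' S) :=
    (by fun_prop : Measurable fun x : ℝ => 3 * x - 3 * b) hS
  rw [← integrable_indicator_iff hm, ← integrable_indicator_iff hS, preimage_three_mul_sub]
  rw [integrable_comp_mul_left_iff (fun y => S.indicator (fun z => F (z / 3 + b)) (y - 3 * b))
    (by norm_num : (3 : ℝ) ≠ 0)]
  exact ⟨fun h => by simpa using h.comp_add_right (3 * b), fun h => h.comp_sub_right (3 * b)⟩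

lemma setIntegral_preimage_three_mul_sub {b : ℝ} {S : Set ℝ} (hS : MeasurableSet S) (F : ℝ → ℝ) :
    ∫ x in (fun x => 3 * x - 3 * b) ⁻¹' S, F x = (1 / 3) * ∫ z in S, F (z / 3 + b) := by
  have hm : MeasurableSet ((fun x : ℝ => 3 * x - 3 * b) ⁻¹' S) :=
    (by fun_prop : Measurable fun x : ℝ => 3 * x - 3 * b) hS
  rw [← integral_indicator hm, ← integral_indicator hS, preimage_three_mul_sub,
    Measure.integral_comp_mul_left (fun y => S.indicator (fun z => F (z / 3 + b)) (y - 3 * b)),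
    integral_sub_right_eq_self (fun y => S.indicator (fun z => F (z / 3 + b)) y)]
  norm_num

/-- Writing both maps as 3x - 3b, with b = 0 and b = 2/3, lets one change of variables serve for the
two halves. -/
lemma lineDomain_succ' (n : ℕ) :
    lineDomain (n + 1) = (fun x => 3 * x - 3 * 0) ⁻¹' lineDomain n ∪
      (fun x => 3 * x - 3 * (2 / 3)) ⁻¹' lineDomain n := by
  rw [lineDomain_succ]; norm_num

lemma measurableSet_lineDomain (n : ℕ) : MeasurableSet (lineDomain n) :=
  (isOpen_lineDomain n).measurableSet

lemma integrableOn_lineDomain_succ {n : ℕ} {F : ℝ → ℝ} :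
    IntegrableOn F (lineDomain (n + 1)) ↔ IntegrableOn (fun z => F (z / 3 + 0)) (lineDomain n) ∧
      IntegrableOn (fun z => F (z / 3 + 2 / 3)) (lineDomain n) := by
  rw [lineDomain_succ', integrableOn_union,
    integrableOn_preimage_three_mul_sub (measurableSet_lineDomain n),
    integrableOn_preimage_three_mul_sub (measurableSet_lineDomain n)]

lemma setIntegral_lineDomain_succ {n : ℕ} {F : ℝ → ℝ} (hF : IntegrableOn F (lineDomain (n + 1))) :
    ∫ x in lineDomain (n + 1), F x = (1 / 3) * (∫ z in lineDomain n, F (z / 3 + 0)) +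
      (1 / 3) * ∫ z in lineDomain n, F (z / 3 + 2 / 3) := by
  have hd : Disjoint ((fun x => 3 * x - 3 * 0) ⁻¹' lineDomain n)
      ((fun x => 3 * x - 3 * (2 / 3)) ⁻¹' lineDomain n) := by
    have h0 : (fun x : ℝ => 3 * x - 3 * 0) = fun x => 3 * x := by ext; ring
    have h1 : (fun x : ℝ => 3 * x - 3 * (2 / 3)) = fun x => 3 * x - 2 := by ext; ring
    rw [h0, h1]
    exact disjoint_lineDomain_preimages n
  rw [lineDomain_succ', integrableOn_union] at hF
  rw [lineDomain_succ', setIntegral_union hd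
    ((by fun_prop : Measurable fun x : ℝ => 3 * x - 3 * (2 / 3)) (measurableSet_lineDomain n))
    hF.1 hF.2, setIntegral_preimage_three_mul_sub (measurableSet_lineDomain n),
    setIntegral_preimage_three_mul_sub (measurableSet_lineDomain n)]

lemma volume_lineDomain_lt_top (n : ℕ) : volume (lineDomain n) < ⊤ :=
  (measure_mono (lineDomain_subset n)).trans_lt (by simp)

lemma volume_real_lineDomain (n : ℕ) : volume.real (lineDomain n) = 2 * (2 / 3) ^ n := by
  induction n with
  | zero => rw [lineDomain_zero]; norm_num [Measure.real]
  | succ n ih =>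
    have h := setIntegral_lineDomain_succ (n := n) (F := fun _ => (1 : ℝ))
      (integrableOn_const (volume_lineDomain_lt_top _).ne)
    simp only [setIntegral_const, smul_eq_mul, mul_one] at h
    rw [h, ih, pow_succ]; ring

lemma volume_real_lineDomain_pos (n : ℕ) : 0 < volume.real (lineDomain n) := by
  rw [volume_real_lineDomain]; positivity

/-- The average of `f` over `D_n`. -/
def lineAverage (n : ℕ) (f : ℝ → ℝ) : ℝ := (volume.real (lineDomain n))⁻¹ * ∫ x in lineDomain n, f x

/-- The two halves have equal measure, so the average is the plain mean of the averages of the two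
rescaled functions. This yields the factor 1/2 per generation. -/
lemma lineAverage_succ {n : ℕ} {f : ℝ → ℝ} (hf : IntegrableOn f (lineDomain (n + 1))) :
    lineAverage (n + 1) f = (lineAverage n (fun z => f (z / 3 + 0)) +
      lineAverage n (fun z => f (z / 3 + 2 / 3))) / 2 := by
  have h : (volume.real (lineDomain (n + 1)))⁻¹ = 3 / 2 * (volume.real (lineDomain n))⁻¹ := by
    rw [volume_real_lineDomain, volume_real_lineDomain, pow_succ]; field_simp
  rw [lineAverage, lineAverage, lineAverage, setIntegral_lineDomain_succ hf, h]
  ring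

lemma lineAverage_congr {n : ℕ} {f g : ℝ → ℝ} (h : ∀ᵐ x ∂volume.restrict (lineDomain n), f x = g x) :
    lineAverage n f = lineAverage n g := by
  rw [lineAverage, lineAverage, integral_congr_ae h]

lemma lineAverage_const (n : ℕ) (c : ℝ) : lineAverage n (fun _ => c) = c := by
  rw [lineAverage, setIntegral_const, smul_eq_mul,
    inv_mul_cancel_left₀ (volume_real_lineDomain_pos n).ne']

lemma lineAverage_sub {n : ℕ} {f g : ℝ → ℝ} (hf : IntegrableOn f (lineDomain n))
    (hg : IntegrableOn g (lineDomain n)) :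
    lineAverage n (fun x => f x - g x) = lineAverage n f - lineAverage n g := by
  rw [lineAverage, lineAverage, lineAverage, integral_sub hf hg, mul_sub]

lemma abs_lineAverage_le {n : ℕ} {f : ℝ → ℝ} {B : ℝ}
    (h : ∀ᵐ x ∂volume.restrict (lineDomain n), |f x| ≤ B) : |lineAverage n f| ≤ B := by
  have h1 : |∫ x in lineDomain n, f x| ≤ B * volume.real (lineDomain n) := by
    have := norm_setIntegral_le_of_norm_le_const_ae (f := f) (volume_lineDomain_lt_top n) h
    simpa using this
  have hp := volume_real_lineDomain_pos n
  rw [lineAverage, abs_mul, abs_of_pos (inv_pos.2 hp), inv_mul_le_iff₀ hp, mul_comm]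
  exact h1

lemma abs_lineAverage_le_integral (n : ℕ) (f : ℝ → ℝ) :
    |lineAverage n f| ≤ (volume.real (lineDomain n))⁻¹ * ∫ x in lineDomain n, |f x| := by
  have hp := volume_real_lineDomain_pos n
  rw [lineAverage, abs_mul, abs_of_pos (inv_pos.2 hp)]
  gcongr
  exact abs_integral_le_integral_abs

/-- On each interval with rational ends contained in `D`, the function `f` is almost everywhere
equal to a primitive of `g`. -/
def IsPrimitiveOn (D : Set ℝ) (f g : ℝ → ℝ) : Prop :=
  ∀ a b : ℚ, (a : ℝ) < b → Ioo (a : ℝ) b ⊆ D →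
    ∃ k : ℝ, ∀ᵐ x ∂volume.restrict (Ioo (a : ℝ) b), f x = k + ∫ s in (a : ℝ)..x, g s

lemma quasiMeasurePreserving_div_add (c b : ℝ) (hc : c ≠ 0) :
    Measure.QuasiMeasurePreserving (fun z : ℝ => z / c + b) volume volume := by
  have h1 : Measure.QuasiMeasurePreserving (fun z : ℝ => c⁻¹ * z) volume volume := by
    refine ⟨by fun_prop, ?_⟩
    rw [Real.map_volume_mul_left (inv_ne_zero hc)]
    exact Measure.smul_absolutelyContinuous
  convert (measurePreserving_add_right volume b).quasiMeasurePreserving.comp h1 using 1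
  ext z; simp; ring

/-- The shift `b` is rational so that rational endpoints stay rational; the division by 3 is the
chain rule. -/
lemma IsPrimitiveOn.comp_div_add {S D : Set ℝ} {f g : ℝ → ℝ} (h : IsPrimitiveOn D f g) (b : ℚ)
    (hS : (fun x : ℝ => 3 * x - 3 * b) ⁻¹' S ⊆ D) :
    IsPrimitiveOn S (fun z => f (z / 3 + b)) (fun z => g (z / 3 + b) / 3) := by
  intro p q hpq hpqS
  obtain ⟨k, hk⟩ := h (p / 3 + b) (q / 3 + b) (by push_cast; linarith) (by
    push_cast
    intro x hx
    exact hS (hpqS ⟨by linarith [hx.1], by linarith [hx.2]⟩))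
  refine ⟨k, ?_⟩
  rw [ae_restrict_iff' measurableSet_Ioo] at hk ⊢
  filter_upwards [(quasiMeasurePreserving_div_add 3 b (by norm_num)).ae hk] with z hz hzpq
  rw [hz (by push_cast; exact ⟨by linarith [hzpq.1], by linarith [hzpq.2]⟩),
    intervalIntegral.integral_div,
    intervalIntegral.integral_comp_div_add g (by norm_num : (3 : ℝ) ≠ 0)]
  push_cast
  simp

/-- Induction on the generation. Rescaling preserves the integral of the absolute derivative over
each half, while the average over the next generation is the mean of the two rescaled averages, so
every step gains a factor 1/2. -/
lemma abs_lineAverage_sub_succ_le (n : ℕ) {f g : ℝ → ℝ} (hf : IntegrableOn f (lineDomain n))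
    (hg : IntegrableOn g (lineDomain n)) (hfg : IsPrimitiveOn (lineDomain n) f g) :
    |lineAverage n f - lineAverage (n + 1) f| ≤ 2 * (1 / 2) ^ n * ∫ x in lineDomain n, |g x| := by
  induction n generalizing f g with
  | zero =>
    -- D_0 is a single interval, on which f stays within ∫ |g| of the constant k. Both averages are
    -- therefore that close to k, whence the constant 2.
    obtain ⟨k, hk⟩ := hfg (-(1 / 2)) (3 / 2) (by norm_num) (by rw [lineDomain_zero]; push_cast; rfl)
    have hD : Ioo ((-(1 / 2) : ℚ) : ℝ) ((3 / 2 : ℚ) : ℝ) = lineDomain 0 := by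
      rw [lineDomain_zero]; push_cast; rfl
    rw [hD] at hk
    have hb : ∀ᵐ x ∂volume.restrict (lineDomain 0), |f x - k| ≤ ∫ x in lineDomain 0, |g x| := by
      filter_upwards [hk, ae_restrict_mem (measurableSet_lineDomain 0)] with x hx hxD
      rw [hx, add_sub_cancel_left, lineDomain_zero]
      rw [lineDomain_zero] at hxD hg
      push_cast
      have h1 : -(1 / 2) ≤ x := hxD.1.le
      refine (intervalIntegral.abs_integral_le_integral_abs h1).trans ?_
      rw [intervalIntegral.integral_of_le h1, ← integral_Ioc_eq_integral_Ioo]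
      refine setIntegral_mono_set ?_ (ae_of_all _ fun _ => abs_nonneg _)
        (Ioc_subset_Ioc_right hxD.2.le).eventuallyLE
      rw [integrableOn_Ioc_iff_integrableOn_Ioo]
      exact hg.abs
    have h0 := abs_lineAverage_le hb
    have h1 := abs_lineAverage_le (n := 1) (ae_restrict_of_ae_restrict_of_subset
      (lineDomain_succ_subset 0) hb)
    have hc (m : ℕ) : IntegrableOn (fun _ => k) (lineDomain m) :=
      integrableOn_const (volume_lineDomain_lt_top _).ne
    rw [lineAverage_sub hf (hc 0), lineAverage_const] at h0
    rw [lineAverage_sub (hf.mono_set (lineDomain_succ_subset 0)) (hc 1), lineAverage_const] at h1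
    rw [zero_add]
    rw [abs_le] at *
    constructor <;> linarith
  | succ n ih =>
    have hs := integrableOn_lineDomain_succ.1 hf
    have hgs := integrableOn_lineDomain_succ.1 hg
    have hss := integrableOn_lineDomain_succ.1 (hf.mono_set (lineDomain_succ_subset (n + 1)))
    have hu := lineDomain_succ' n
    have i0 := ih hs.1 (hgs.1.div_const 3) (by
      simpa using hfg.comp_div_add (S := lineDomain n) 0
        (by push_cast; rw [hu]; exact subset_union_left))
    have i1 := ih hs.2 (hgs.2.div_const 3) (by
      simpa using hfg.comp_div_add (S := lineDomain n) (2 / 3)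
        (by push_cast; rw [hu]; exact subset_union_right))
    have hI := setIntegral_lineDomain_succ hg.abs
    simp only [abs_div, integral_div, abs_of_pos (by norm_num : (0 : ℝ) < 3)] at i0 i1
    rw [lineAverage_succ hf, lineAverage_succ (hf.mono_set (lineDomain_succ_subset (n + 1))), hI]
    rw [abs_le] at *
    have e (A B : ℝ) : 2 * (1 / 2 : ℝ) ^ (n + 1) * (1 / 3 * A + 1 / 3 * B)
      = (2 * (1 / 2 : ℝ) ^ n * (A / 3) + 2 * (1 / 2 : ℝ) ^ n * (B / 3)) / 2 := by
      rw [pow_succ]; ring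
    rw [e]
    constructor <;> linarith

/-! ## Absolute continuity on lines -/

/-- A smooth function with values in `[0, 1]` that vanishes outside `[p, q]` and tends to the
indicator function of `(p, q)` as `m → ∞`. -/
def plateau (p q : ℝ) (m : ℕ) (y : ℝ) : ℝ :=
  Real.smoothTransition (m * (y - p)) * Real.smoothTransition (m * (q - y))

lemma contDiff_plateau (p q : ℝ) (m : ℕ) : ContDiff ℝ ∞ (plateau p q m) :=
  (Real.smoothTransition.contDiff.comp (by fun_prop)).mul
    (Real.smoothTransition.contDiff.comp (by fun_prop))

lemma plateau_nonneg (p q : ℝ) (m : ℕ) (y : ℝ) : 0 ≤ plateau p q m y :=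
  mul_nonneg (Real.smoothTransition.nonneg _) (Real.smoothTransition.nonneg _)

lemma plateau_le_one (p q : ℝ) (m : ℕ) (y : ℝ) : plateau p q m y ≤ 1 :=
  mul_le_one₀ (Real.smoothTransition.le_one _) (Real.smoothTransition.nonneg _)
    (Real.smoothTransition.le_one _)

lemma plateau_eq_zero {p q y : ℝ} (m : ℕ) (h : y ∉ Ioo p q) : plateau p q m y = 0 := by
  rw [plateau]
  by_cases h1 : y ≤ p
  · rw [Real.smoothTransition.zero_of_nonpos (x := m * (y - p)), zero_mul]
    exact mul_nonpos_of_nonneg_of_nonpos (by positivity) (by linarith)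
  · rw [Real.smoothTransition.zero_of_nonpos (x := m * (q - y)), mul_zero]
    refine mul_nonpos_of_nonneg_of_nonpos (by positivity) ?_
    by_contra h2
    exact h ⟨not_le.1 h1, by linarith⟩

lemma plateau_eventually_eq_one {p q y : ℝ} (h : y ∈ Ioo p q) :
    ∀ᶠ m : ℕ in atTop, plateau p q m y = 1 := by
  have h1 : Tendsto (fun m : ℕ => (m : ℝ) * (y - p)) atTop atTop :=
    tendsto_natCast_atTop_atTop.atTop_mul_const (by linarith [h.1])
  have h2 : Tendsto (fun m : ℕ => (m : ℝ) * (q - y)) atTop atTop :=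
    tendsto_natCast_atTop_atTop.atTop_mul_const (by linarith [h.2])
  filter_upwards [h1.eventually_ge_atTop 1, h2.eventually_ge_atTop 1] with m hm1 hm2
  rw [plateau, Real.smoothTransition.one_of_one_le hm1, Real.smoothTransition.one_of_one_le hm2,
    one_mul]

lemma integral_plateau_pos {p q : ℝ} (h : p < q) : 0 < ∫ y, plateau p q 1 y := by
  have hc : HasCompactSupport (plateau p q 1) :=
    HasCompactSupport.intro (isCompact_Icc (a := p) (b := q)) fun y hy =>
      plateau_eq_zero 1 fun h => hy (Ioo_subset_Icc_self h)
  refine (contDiff_plateau p q 1).continuous.integral_pos_of_hasCompactSupport_nonneg_nonzero hc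
    (plateau_nonneg p q 1) (x := (p + q) / 2) ?_
  refine (mul_pos (Real.smoothTransition.pos_of_pos ?_) (Real.smoothTransition.pos_of_pos ?_)).ne' <;>
  · push_cast; linarith

/-- Letting m → ∞ shows that the integral of w over each rational subinterval vanishes. The
primitive of w is continuous and zero at the rationals of the interval, hence zero there, and
Lebesgue differentiation gives the claim. Only countably many test functions are involved. -/
lemma ae_eq_zero_of_integral_mul_plateau {c d : ℝ} {w : ℝ → ℝ} (hw : IntegrableOn w (Ioo c d))
    (h : ∀ p q : ℚ, c < p → (p : ℝ) < q → (q : ℝ) < d → ∀ m : ℕ,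
      ∫ y in Ioo c d, w y * plateau p q m y = 0) :
    ∀ᵐ y ∂volume.restrict (Ioo c d), w y = 0 := by
  set u := (Ioo c d).indicator w with hu
  have hui : Integrable u := (integrable_indicator_iff measurableSet_Ioo).2 hw
  have hpq : ∀ p q : ℚ, c < p → (p : ℝ) < q → (q : ℝ) < d → ∫ y in (p : ℝ)..q, u y = 0 := by
    intro p q hp hpq hq
    have ht : Tendsto (fun m : ℕ => ∫ y in Ioo c d, w y * plateau p q m y) atTop
        (𝓝 (∫ y in Ioo c d, (Ioo (p : ℝ) q).indicator w y)) := by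
      refine tendsto_integral_of_dominated_convergence (fun y => |w y|) (fun m =>
        hw.aestronglyMeasurable.mul (contDiff_plateau p q m).continuous.aestronglyMeasurable)
        hw.abs (fun m => ae_of_all _ fun y => ?_) (ae_of_all _ fun y => ?_)
      · rw [Real.norm_eq_abs, abs_mul, abs_of_nonneg (plateau_nonneg _ _ _ _)]
        exact mul_le_of_le_one_right (abs_nonneg _) (plateau_le_one _ _ _ _)
      · by_cases hy : y ∈ Ioo (p : ℝ) q
        · rw [indicator_of_mem hy]
          refine tendsto_const_nhds.congr' ?_
          filter_upwards [plateau_eventually_eq_one hy] with m hm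
          rw [hm, mul_one]
        · rw [indicator_of_notMem hy]
          simp [plateau_eq_zero _ hy]
    simp only [h p q hp hpq hq] at ht
    have h0 := tendsto_nhds_unique ht tendsto_const_nhds
    rw [setIntegral_indicator measurableSet_Ioo, inter_eq_right.2 (Ioo_subset_Ioo hp.le hq.le)] at h0
    rw [intervalIntegral.integral_of_le hpq.le, integral_Ioc_eq_integral_Ioo, ← h0]
    refine setIntegral_congr_fun measurableSet_Ioo fun y hy => ?_
    exact indicator_of_mem (show y ∈ Ioo c d from ⟨hp.trans hy.1, hy.2.trans hq⟩) w
  rw [ae_restrict_iff' measurableSet_Ioo]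
  filter_upwards [LocallyIntegrable.ae_hasDerivAt_integral hui.locallyIntegrable] with x hx hxcd
  -- The base point of the primitive must be rational, so that the hypothesis applies between it and
  -- each rational.
  obtain ⟨p0, hp0⟩ := exists_rat_btwn (hxcd.1.trans hxcd.2)
  have hcont : Continuous fun y => ∫ t in (p0 : ℝ)..y, u t :=
    intervalIntegral.continuous_primitive (fun a b => hui.intervalIntegrable) _
  have hzero : Ioo c d ⊆ {y | ∫ t in (p0 : ℝ)..y, u t = 0} := by
    refine (Rat.denseRange_cast.open_subset_closure_inter isOpen_Ioo).trans
      (closure_minimal ?_ (isClosed_eq hcont continuous_const))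
    rintro _ ⟨hy, q, rfl⟩
    rcases lt_trichotomy (p0 : ℝ) q with hlt | heq | hgt
    · exact hpq p0 q hp0.1 hlt hy.2
    · simp [heq]
    · rw [mem_ofPred_eq, intervalIntegral.integral_symm, hpq q p0 hy.1 hgt hp0.2, neg_zero]
  have hd : HasDerivAt (fun _ : ℝ => (0 : ℝ)) (u x) x :=
    (hx p0).congr_of_eventuallyEq (by
      filter_upwards [isOpen_Ioo.mem_nhds hxcd] with y hy
      exact (hzero hy).symm)
  have := hd.unique (hasDerivAt_const x 0)
  rwa [hu, indicator_of_mem hxcd] at this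

/-- A smooth function with zero mean: a plateau function minus a multiple of a fixed one. -/
def zeroMeanPlateau (p₀ q₀ p q : ℝ) (m : ℕ) (y : ℝ) : ℝ :=
  plateau p q m y - ((∫ t, plateau p q m t) / ∫ t, plateau p₀ q₀ 1 t) * plateau p₀ q₀ 1 y

/-- The zero mean is what makes the primitive vanish to the right of the supports as well, so that
it is an admissible test function. -/
lemma exists_primitive_zeroMeanPlateau {c d p₀ q₀ p q : ℝ} (hp₀ : c < p₀) (h₀ : p₀ < q₀)
    (hq₀ : q₀ < d) (hp : c < p) (hpq : p < q) (hq : q < d) (m : ℕ) :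
    ∃ γ : ℝ → ℝ, ContDiff ℝ ∞ γ ∧ HasCompactSupport γ ∧ tsupport γ ⊆ Ioo c d ∧
      deriv γ = zeroMeanPlateau p₀ q₀ p q m := by
  set η := zeroMeanPlateau p₀ q₀ p q m with hη
  have hηs : ContDiff ℝ ∞ η := (contDiff_plateau p q m).sub (contDiff_const.mul (contDiff_plateau _ _ _))
  have hη0 : ∀ y ∉ Ioo (min p p₀) (max q q₀), η y = 0 := by
    intro y hy
    rw [hη, zeroMeanPlateau, plateau_eq_zero _ (fun h => hy ⟨min_lt_of_left_lt h.1, lt_max_of_lt_left h.2⟩),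
      plateau_eq_zero _ (fun h => hy ⟨min_lt_of_right_lt h.1, lt_max_of_lt_right h.2⟩)]
    simp
  have hi (a b : ℝ) (k : ℕ) : Integrable (plateau a b k) :=
    (contDiff_plateau a b k).continuous.integrable_of_hasCompactSupport
      (HasCompactSupport.intro (isCompact_Icc (a := a) (b := b)) fun y hy =>
        plateau_eq_zero k fun h => hy (Ioo_subset_Icc_self h))
  have hint : ∫ y, η y = 0 := by
    simp only [hη, zeroMeanPlateau]
    rw [integral_sub (hi _ _ _) ((hi _ _ _).const_mul _), integral_const_mul,
      div_mul_cancel₀ _ (integral_plateau_pos h₀).ne', sub_self]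
  have hder (y : ℝ) : HasDerivAt (fun y => ∫ t in min p p₀..y, η t) (η y) y :=
    intervalIntegral.integral_hasDerivAt_right (hηs.continuous.intervalIntegrable _ _)
      (hηs.continuous.stronglyMeasurableAtFilter _ _) hηs.continuous.continuousAt
  have hmm : min p p₀ < max q q₀ := (min_le_left _ _).trans_lt (hpq.trans_le (le_max_left _ _))
  have hsupp : ∀ y ∉ Icc (min p p₀) (max q q₀), ∫ t in min p p₀..y, η t = 0 := by
    intro y hy
    by_cases hy1 : y ≤ min p p₀
    · rw [intervalIntegral.integral_symm, intervalIntegral.integral_of_le hy1,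
        integral_Ioc_eq_integral_Ioo, setIntegral_congr_fun (g := fun _ => 0) measurableSet_Ioo
          fun t ht => hη0 t fun h => absurd h.1 ht.2.not_gt]
      simp
    · have hy2 : max q q₀ < y := not_le.1 fun h => hy ⟨(not_le.1 hy1).le, h⟩
      rw [intervalIntegral.integral_of_le (not_le.1 hy1).le, ← hint]
      refine setIntegral_eq_integral_of_forall_compl_eq_zero fun t ht => hη0 t fun h => ht ?_
      exact ⟨h.1, (h.2.trans hy2).le⟩
  have hd : deriv (fun y => ∫ t in min p p₀..y, η t) = η := funext fun y => (hder y).deriv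
  refine ⟨_, ?_, HasCompactSupport.intro isCompact_Icc hsupp, ?_, hd⟩
  · rw [contDiff_infty_iff_deriv, hd]
    exact ⟨fun y => (hder y).differentiableAt, hηs⟩
  · refine (closure_minimal (fun y hy => ?_) isClosed_Icc).trans
      (Icc_subset_Ioo (lt_min hp hp₀) (max_lt hq hq₀))
    by_contra h
    exact hy (hsupp y h)

/-- The du Bois-Reymond argument with a countable family of tests. For P a primitive of g,
integration by parts turns the hypothesis into the vanishing of the integral of (f - P) against
zero-mean plateaus; thus f - P minus a constant is orthogonal to all rational plateaus. -/
lemma exists_ae_eq_primitive {c d p₀ q₀ : ℝ} (hp₀ : c < p₀) (h₀ : p₀ < q₀) (hq₀ : q₀ < d)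
    {f g : ℝ → ℝ} (hf : IntegrableOn f (Ioo c d)) (hg : IntegrableOn g (Ioo c d))
    {γ : ℚ → ℚ → ℕ → ℝ → ℝ}
    (hγ : ∀ p q : ℚ, c < p → (p : ℝ) < q → (q : ℝ) < d → ∀ m : ℕ, ContDiff ℝ ∞ (γ p q m) ∧
      tsupport (γ p q m) ⊆ Ioo c d ∧ deriv (γ p q m) = zeroMeanPlateau p₀ q₀ p q m ∧
      ∫ y in Ioo c d, (f y * deriv (γ p q m) y + g y * γ p q m y) = 0) :
    ∃ k : ℝ, ∀ᵐ y ∂volume.restrict (Ioo c d), f y = k + ∫ s in c..y, g s := by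
  have hcd : c < d := hp₀.trans (h₀.trans hq₀)
  have hgI : IntervalIntegrable g volume c d :=
    (intervalIntegrable_iff_integrableOn_Ioo_of_le hcd.le).2 hg
  have hP := hgI.absolutelyContinuousOnInterval_intervalIntegral (c := c) left_mem_uIcc
  set P : ℝ → ℝ := fun y => ∫ s in c..y, g s with hPdef
  have hPc : ContinuousOn P (Icc c d) := by simpa [uIcc_of_le hcd.le] using hP.continuousOn
  have hPi : IntegrableOn P (Ioo c d) :=
    (hPc.integrableOn_compact isCompact_Icc).mono_set Ioo_subset_Icc_self
  have hmul {u β : ℝ → ℝ} (hu : IntegrableOn u (Ioo c d)) (hβ : Continuous β) :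
      IntegrableOn (fun y => u y * β y) (Ioo c d) := by
    obtain ⟨C, hC⟩ := (isCompact_Icc (a := c) (b := d)).exists_bound_of_continuousOn hβ.continuousOn
    refine Integrable.mul_bdd (c := C) hu hβ.aestronglyMeasurable ?_
    filter_upwards [ae_restrict_mem measurableSet_Ioo] with y hy using hC y (Ioo_subset_Icc_self hy)
  -- The weighted mean of f - P against the fixed plateau: the only constant compatible with the
  -- zero-mean tests.
  set k : ℝ := (∫ y in Ioo c d, (f y - P y) * plateau p₀ q₀ 1 y) / ∫ t, plateau p₀ q₀ 1 t
  refine ⟨k, ?_⟩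
  have hfP : IntegrableOn (fun y => f y - P y) (Ioo c d) := hf.sub hPi
  have hw : IntegrableOn (fun y => f y - P y - k) (Ioo c d) :=
    hfP.sub (integrableOn_const (by simp))
  suffices hz : ∀ p q : ℚ, c < p → (p : ℝ) < q → (q : ℝ) < d → ∀ m : ℕ,
      ∫ y in Ioo c d, (f y - P y - k) * plateau p q m y = 0 by
    filter_upwards [ae_eq_zero_of_integral_mul_plateau hw hz] with y hy
    linarith
  intro p q hp hpq hq m
  obtain ⟨h1, h2, h3, h4⟩ := hγ p q hp hpq hq m
  set G := γ p q m
  have hGc : G c = 0 := by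
    by_contra h
    exact absurd (h2 (subset_tsupport _ h)).1 (lt_irrefl _)
  have hGd : G d = 0 := by
    by_contra h
    exact absurd (h2 (subset_tsupport _ h)).2 (lt_irrefl _)
  have hGac : AbsolutelyContinuousOnInterval G c d :=
    (h1.of_le (by norm_cast)).contDiffOn.absolutelyContinuousOnInterval
  have ibp := hGac.integral_mul_deriv_eq_deriv_mul hP
  rw [hGc, hGd, zero_mul, zero_mul, sub_zero, zero_sub] at ibp
  have e1 : ∫ x in c..d, G x * deriv P x = ∫ y in Ioo c d, g y * G y := by
    rw [← integral_Ioc_eq_integral_Ioo, ← intervalIntegral.integral_of_le hcd.le]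
    refine intervalIntegral.integral_congr_ae ?_
    filter_upwards [hgI.ae_hasDerivAt_integral] with y hy hy'
    rw [(hy (uIoc_subset_uIcc hy') c left_mem_uIcc).deriv, mul_comm]
  have e2 : ∫ x in c..d, deriv G x * P x = ∫ y in Ioo c d, P y * deriv G y := by
    rw [intervalIntegral.integral_of_le hcd.le, integral_Ioc_eq_integral_Ioo]
    simp_rw [mul_comm]
  rw [e1, e2] at ibp
  have hdG : Continuous (deriv G) := h1.continuous_deriv (by norm_cast)
  rw [integral_add (hmul hf hdG) (hmul hg h1.continuous), ibp, ← sub_eq_add_neg,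
    ← integral_sub (hmul hf hdG) (hmul hPi hdG)] at h4
  have hpl (a b : ℝ) (n : ℕ) := (contDiff_plateau a b n).continuous
  have hpI : ∫ y in Ioo c d, plateau p q m y = ∫ y, plateau p q m y :=
    setIntegral_eq_integral_of_forall_compl_eq_zero fun y hy => plateau_eq_zero _ fun h =>
      hy ⟨hp.trans h.1, h.2.trans hq⟩
  have h5 : ∫ y in Ioo c d, (f y - P y) * plateau p q m y = k * ∫ y, plateau p q m y := by
    have : ∀ y, f y * deriv G y - P y * deriv G y = (f y - P y) * plateau p q m y -
        ((∫ t, plateau p q m t) / ∫ t, plateau p₀ q₀ 1 t) * ((f y - P y) * plateau p₀ q₀ 1 y) := by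
      intro y; rw [h3, zeroMeanPlateau]; ring
    simp_rw [this] at h4
    rw [integral_sub (hmul hfP (hpl _ _ _)) ((hmul hfP (hpl _ _ _)).const_mul _),
      integral_const_mul] at h4
    simp only [k]
    rw [sub_eq_zero.1 h4]
    ring
  simp_rw [sub_mul _ k]
  rw [integral_sub (hmul hfP (hpl _ _ _)), h5, integral_const_mul, hpI, sub_self]
  exact (((hpl _ _ _).integrableOn_Icc (a := c) (b := d)).mono_set Ioo_subset_Icc_self).const_mul k

/-- For a fixed γ, Fubini and the fundamental lemma in the variable x give the one-dimensional
identity for almost every x. As the functions γ form a countable family, a single null set of x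
serves for all of them, and `exists_ae_eq_primitive` applies on each remaining line. -/
theorem ae_exists_ae_eq_primitive {D : Set ℝ} (hD : IsOpen D) {c d : ℝ} (hcd : c < d)
    {V G : ℝ × ℝ → ℝ}
    (hV : Integrable V ((volume.restrict D).prod (volume.restrict (Ioo c d))))
    (hG : Integrable G ((volume.restrict D).prod (volume.restrict (Ioo c d))))
    (h : ∀ α γ : ℝ → ℝ, ContDiff ℝ ∞ α → HasCompactSupport α → tsupport α ⊆ D →
      ContDiff ℝ ∞ γ → HasCompactSupport γ → tsupport γ ⊆ Ioo c d →
      ∫ z, V z * (α z.1 * deriv γ z.2) ∂(volume.restrict D).prod (volume.restrict (Ioo c d)) =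
        -∫ z, G z * (α z.1 * γ z.2) ∂(volume.restrict D).prod (volume.restrict (Ioo c d))) :
    ∀ᵐ x ∂volume.restrict D, IntegrableOn (fun y => G (x, y)) (Ioo c d) ∧
      ∃ k : ℝ, ∀ᵐ y ∂volume.restrict (Ioo c d), V (x, y) = k + ∫ s in c..y, G (x, s) := by
  obtain ⟨p₀, hp₀, hp₀d⟩ := exists_between hcd
  obtain ⟨q₀, h₀, hq₀⟩ := exists_between hp₀d
  have hex : ∀ p q : ℚ, ∀ m : ℕ, ∃ γ : ℝ → ℝ, c < p → (p : ℝ) < q → (q : ℝ) < d →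
      ContDiff ℝ ∞ γ ∧ HasCompactSupport γ ∧ tsupport γ ⊆ Ioo c d ∧
        deriv γ = zeroMeanPlateau p₀ q₀ p q m := by
    intro p q m
    by_cases hh : c < p ∧ (p : ℝ) < q ∧ (q : ℝ) < d
    · obtain ⟨γ, hγ⟩ := exists_primitive_zeroMeanPlateau hp₀ h₀ hq₀ hh.1 hh.2.1 hh.2.2 m
      exact ⟨γ, fun _ _ _ => hγ⟩
    · exact ⟨0, fun h1 h2 h3 => absurd ⟨h1, h2, h3⟩ hh⟩
  choose γ hγ using hex
  have hbd {u : ℝ × ℝ → ℝ} {a b : ℝ → ℝ}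
      (hu : Integrable u ((volume.restrict D).prod (volume.restrict (Ioo c d))))
      (ha : Continuous a) (ha' : HasCompactSupport a) (hb : Continuous b)
      (hb' : HasCompactSupport b) :
      Integrable (fun z => u z * (a z.1 * b z.2))
        ((volume.restrict D).prod (volume.restrict (Ioo c d))) := by
    obtain ⟨A, hA⟩ := ha'.exists_bound_of_continuous ha
    obtain ⟨B, hB⟩ := hb'.exists_bound_of_continuous hb
    refine hu.mul_bdd (c := A * B) (by fun_prop) (ae_of_all _ fun z => ?_)
    rw [norm_mul]
    exact mul_le_mul (hA _) (hB _) (norm_nonneg _) ((norm_nonneg _).trans (hA 0))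
  have key : ∀ p q : ℚ, ∀ m : ℕ, ∀ᵐ x ∂volume.restrict D, c < p → (p : ℝ) < q → (q : ℝ) < d →
      ∫ y in Ioo c d, (V (x, y) * deriv (γ p q m) y + G (x, y) * γ p q m y) = 0 := by
    intro p q m
    by_cases hh : c < p ∧ (p : ℝ) < q ∧ (q : ℝ) < d
    swap
    · exact ae_of_all _ fun x h1 h2 h3 => absurd ⟨h1, h2, h3⟩ hh
    obtain ⟨g1, g2, g3, g4⟩ := hγ p q m hh.1 hh.2.1 hh.2.2
    have hdc : Continuous (deriv (γ p q m)) := g1.continuous_deriv (by norm_cast)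
    have hint : Integrable (fun z : ℝ × ℝ => V z * deriv (γ p q m) z.2 + G z * γ p q m z.2)
        ((volume.restrict D).prod (volume.restrict (Ioo c d))) := by
      obtain ⟨A, hA⟩ := g2.deriv.exists_bound_of_continuous hdc
      obtain ⟨B, hB⟩ := g2.exists_bound_of_continuous g1.continuous
      exact (hV.mul_bdd (c := A) (by fun_prop) (ae_of_all _ fun z => hA _)).add
        (hG.mul_bdd (c := B) (by have := g1.continuous; fun_prop) (ae_of_all _ fun z => hB _))
    have hloc : IntegrableOn (fun x => ∫ y in Ioo c d,
        (V (x, y) * deriv (γ p q m) y + G (x, y) * γ p q m y)) D := hint.integral_prod_left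
    have := hD.ae_eq_zero_of_integral_contDiff_smul_eq_zero hloc.locallyIntegrableOn ?_
    · rw [ae_restrict_iff' hD.measurableSet]
      filter_upwards [this] with x hx hxD _ _ _ using hx hxD
    intro α a1 a2 a3
    have e0 : ∫ x, α x • ∫ y in Ioo c d, (V (x, y) * deriv (γ p q m) y + G (x, y) * γ p q m y) =
        ∫ x in D, ∫ y in Ioo c d, (V (x, y) * (α x * deriv (γ p q m) y) +
          G (x, y) * (α x * γ p q m y)) := by
      rw [← setIntegral_eq_integral_of_forall_compl_eq_zero (s := D)]
      · refine integral_congr_ae (ae_of_all _ fun x => ?_)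
        simp only [smul_eq_mul]
        rw [← integral_const_mul]
        refine integral_congr_ae (ae_of_all _ fun y => ?_)
        simp only
        ring
      · intro x hx
        rw [image_eq_zero_of_notMem_tsupport fun h => hx (a3 h), zero_smul]
    have i1 := hbd hV a1.continuous a2 hdc g2.deriv
    have i2 := hbd hG a1.continuous a2 g1.continuous g2
    rw [e0, ← integral_prod (fun z : ℝ × ℝ => V z * (α z.1 * deriv (γ p q m) z.2) +
      G z * (α z.1 * γ p q m z.2)) (i1.add i2), integral_add i1 i2,
      h α (γ p q m) a1 a2 a3 g1 g2 g3, neg_add_cancel]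
  have key' := ae_all_iff.2 fun p => ae_all_iff.2 fun q => ae_all_iff.2 (key p q)
  filter_upwards [key', hV.prod_right_ae, hG.prod_right_ae] with x hx hVx hGx
  refine ⟨hGx, exists_ae_eq_primitive hp₀ h₀ hq₀ hVx hGx (γ := γ) fun p q h1 h2 h3 m => ?_⟩
  obtain ⟨g1, g2, g3, g4⟩ := hγ p q m h1 h2 h3
  exact ⟨g1, g3, g4, hx p q m h1 h2 h3⟩

/-! ## Sobolev functions on rectangles of the plane -/

/-- The identification of `ℝ × ℝ` with the Euclidean plane. -/
def toPlane (p : ℝ × ℝ) : EuclideanSpace ℝ (Fin 2) := !₂[p.1, p.2]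

@[simp] lemma toPlane_zero (p : ℝ × ℝ) : toPlane p 0 = p.1 := by simp [toPlane]

@[simp] lemma toPlane_one (p : ℝ × ℝ) : toPlane p 1 = p.2 := by simp [toPlane]

lemma continuous_toPlane : Continuous toPlane := by
  unfold toPlane
  refine (PiLp.continuous_toLp 2 _).comp (continuous_pi fun i => ?_)
  fin_cases i <;> simp <;> fun_prop

/-- The measurable equivalence underlying `toPlane`. -/
def planeEquiv : ℝ × ℝ ≃ᵐ EuclideanSpace ℝ (Fin 2) :=
  MeasurableEquiv.finTwoArrow.symm.trans (MeasurableEquiv.toLp 2 (Fin 2 → ℝ))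

lemma coe_planeEquiv : ⇑planeEquiv = toPlane := by
  ext p i
  fin_cases i <;> simp [planeEquiv, toPlane, MeasurableEquiv.finTwoArrow]

lemma measurePreserving_toPlane : MeasurePreserving toPlane volume volume := by
  rw [← coe_planeEquiv]
  exact (PiLp.volume_preserving_toLp (Fin 2)).comp ((volume_preserving_finTwoArrow ℝ).symm _)

lemma measurableEmbedding_toPlane : MeasurableEmbedding toPlane := by
  rw [← coe_planeEquiv]
  exact planeEquiv.measurableEmbedding

lemma measurePreserving_toPlane_restrict {Ω : Set (EuclideanSpace ℝ (Fin 2))}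
    (hΩ : MeasurableSet Ω) :
    MeasurePreserving toPlane (volume.restrict (toPlane ⁻¹' Ω)) (volume.restrict Ω) :=
  measurePreserving_toPlane.restrict_preimage hΩ

lemma isTestFunction_mul {Ω : Set (EuclideanSpace ℝ (Fin 2))} {D I : Set ℝ} {α γ : ℝ → ℝ}
    (hΩ : D ×ˢ I ⊆ toPlane ⁻¹' Ω) (hα : ContDiff ℝ ∞ α) (hα' : HasCompactSupport α)
    (hαD : tsupport α ⊆ D) (hγ : ContDiff ℝ ∞ γ) (hγ' : HasCompactSupport γ)
    (hγI : tsupport γ ⊆ I) : IsTestFunction Ω (fun z => α (z 0) * γ (z 1)) := by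
  have hK : IsCompact (toPlane '' (tsupport α ×ˢ tsupport γ)) :=
    (hα'.isCompact.prod hγ'.isCompact).image continuous_toPlane
  have hsub : tsupport (fun z : EuclideanSpace ℝ (Fin 2) => α (z 0) * γ (z 1)) ⊆
      toPlane '' (tsupport α ×ˢ tsupport γ) := by
    refine closure_minimal (fun z hz => ⟨(z 0, z 1), ⟨?_, ?_⟩, ?_⟩) hK.isClosed
    · exact subset_tsupport _ (left_ne_zero_of_mul hz)
    · exact subset_tsupport _ (right_ne_zero_of_mul hz)
    · ext i; fin_cases i <;> simp
  refine ⟨?_, hK.of_isClosed_subset (isClosed_tsupport _) hsub, hsub.trans ?_⟩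
  · exact (hα.comp (by fun_prop)).mul (hγ.comp (by fun_prop))
  · rintro _ ⟨p, hp, rfl⟩
    exact hΩ ⟨hαD hp.1, hγI hp.2⟩

lemma fderiv_mul_apply {α γ : ℝ → ℝ} (hα : ContDiff ℝ ∞ α) (hγ : ContDiff ℝ ∞ γ)
    (z v : EuclideanSpace ℝ (Fin 2)) :
    fderiv ℝ (fun z : EuclideanSpace ℝ (Fin 2) => α (z 0) * γ (z 1)) z v =
      α (z 0) * deriv γ (z 1) * v 1 + deriv α (z 0) * γ (z 1) * v 0 := by
  have hp (i : Fin 2) : HasFDerivAt (fun z : EuclideanSpace ℝ (Fin 2) => z i)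
      (EuclideanSpace.proj i : EuclideanSpace ℝ (Fin 2) →L[ℝ] ℝ) z :=
    (EuclideanSpace.proj i : EuclideanSpace ℝ (Fin 2) →L[ℝ] ℝ).hasFDerivAt
  have h1 := ((hα.differentiable (by simp)) (z 0)).hasDerivAt.comp_hasFDerivAt z (hp 0)
  have h2 := ((hγ.differentiable (by simp)) (z 1)).hasDerivAt.comp_hasFDerivAt z (hp 1)
  have h3 := h1.mul h2
  rw [show (fun z : EuclideanSpace ℝ (Fin 2) => α (z 0) * γ (z 1)) =
    (α ∘ fun z : EuclideanSpace ℝ (Fin 2) => z 0) * (γ ∘ fun z : EuclideanSpace ℝ (Fin 2) => z 1)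
    from rfl, h3.fderiv]
  simp
  ring

lemma setIntegral_eq_integral_prod {Ω : Set (EuclideanSpace ℝ (Fin 2))} (hΩo : IsOpen Ω)
    {D I : Set ℝ} (hΩ : D ×ˢ I ⊆ toPlane ⁻¹' Ω)
    {F : EuclideanSpace ℝ (Fin 2) → ℝ} (hF : ∀ z, z 0 ∉ D ∨ z 1 ∉ I → F z = 0) :
    ∫ z in Ω, F z = ∫ p, F (toPlane p) ∂(volume.restrict D).prod (volume.restrict I) := by
  rw [Measure.prod_restrict, ← measurePreserving_toPlane.setIntegral_preimage_emb
    measurableEmbedding_toPlane]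
  refine setIntegral_eq_of_subset_of_forall_sdiff_eq_zero
    (measurableEmbedding_toPlane.measurable hΩo.measurableSet) hΩ fun p hp => hF _ ?_
  rw [toPlane_zero, toPlane_one]
  by_contra! h
  exact hp.2 ⟨h.1, h.2⟩

/-! ### Weak gradients tested against products of functions of one variable -/

section WeakGradient

variable {Ω : Set (EuclideanSpace ℝ (Fin 2))} {u : EuclideanSpace ℝ (Fin 2) → ℝ}
  {g : EuclideanSpace ℝ (Fin 2) → EuclideanSpace ℝ (Fin 2)} {D I : Set ℝ} {α γ : ℝ → ℝ}

lemma IsWeakGradient.integral_mul_deriv_snd (h : IsWeakGradient Ω u g) (hΩo : IsOpen Ω)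
    (hΩ : D ×ˢ I ⊆ toPlane ⁻¹' Ω)
    (hα : ContDiff ℝ ∞ α) (hα' : HasCompactSupport α) (hαD : tsupport α ⊆ D)
    (hγ : ContDiff ℝ ∞ γ) (hγ' : HasCompactSupport γ) (hγI : tsupport γ ⊆ I) :
    ∫ z, u (toPlane z) * (α z.1 * deriv γ z.2) ∂(volume.restrict D).prod (volume.restrict I) =
      -∫ z, g (toPlane z) 1 * (α z.1 * γ z.2) ∂(volume.restrict D).prod (volume.restrict I) := by
  have hα0 : ∀ x ∉ D, α x = 0 := fun x hx => image_eq_zero_of_notMem_tsupport fun h => hx (hαD h)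
  have hγ0 : ∀ x ∉ I, γ x = 0 := fun x hx => image_eq_zero_of_notMem_tsupport fun h => hx (hγI h)
  have hγ1 : ∀ x ∉ I, deriv γ x = 0 := fun x hx =>
    image_eq_zero_of_notMem_tsupport fun h => hx (hγI (tsupport_deriv_subset h))
  have key := h _ (isTestFunction_mul hΩ hα hα' hαD hγ hγ' hγI) (EuclideanSpace.single 1 1)
  simp only [fderiv_mul_apply hα hγ, EuclideanSpace.inner_single_right] at key
  simp only [PiLp.single_apply, if_true, zero_ne_one, if_false, mul_zero, add_zero,
    mul_one, one_mul, conj_trivial] at key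
  rw [setIntegral_eq_integral_prod hΩo hΩ, setIntegral_eq_integral_prod hΩo hΩ] at key
  · simpa using key
  · rintro z (hz | hz)
    · rw [hα0 _ hz]; ring
    · rw [hγ0 _ hz]; ring
  · rintro z (hz | hz)
    · rw [hα0 _ hz]; ring
    · rw [hγ1 _ hz]; ring

lemma IsWeakGradient.integral_mul_deriv_fst (h : IsWeakGradient Ω u g) (hΩo : IsOpen Ω)
    (hΩ : D ×ˢ I ⊆ toPlane ⁻¹' Ω)
    (hα : ContDiff ℝ ∞ α) (hα' : HasCompactSupport α) (hαD : tsupport α ⊆ D)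
    (hγ : ContDiff ℝ ∞ γ) (hγ' : HasCompactSupport γ) (hγI : tsupport γ ⊆ I) :
    ∫ z, u (toPlane z) * (deriv α z.1 * γ z.2) ∂(volume.restrict D).prod (volume.restrict I) =
      -∫ z, g (toPlane z) 0 * (α z.1 * γ z.2) ∂(volume.restrict D).prod (volume.restrict I) := by
  have hα0 : ∀ x ∉ D, α x = 0 := fun x hx => image_eq_zero_of_notMem_tsupport fun h => hx (hαD h)
  have hγ0 : ∀ x ∉ I, γ x = 0 := fun x hx => image_eq_zero_of_notMem_tsupport fun h => hx (hγI h)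
  have hα1 : ∀ x ∉ D, deriv α x = 0 := fun x hx =>
    image_eq_zero_of_notMem_tsupport fun h => hx (hαD (tsupport_deriv_subset h))
  have key := h _ (isTestFunction_mul hΩ hα hα' hαD hγ hγ' hγI) (EuclideanSpace.single 0 1)
  simp only [fderiv_mul_apply hα hγ, EuclideanSpace.inner_single_right] at key
  simp only [PiLp.single_apply, if_true, one_ne_zero, if_false, mul_zero, zero_add,
    mul_one, one_mul, conj_trivial] at key
  rw [setIntegral_eq_integral_prod hΩo hΩ, setIntegral_eq_integral_prod hΩo hΩ] at key
  · simpa using key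
  · rintro z (hz | hz)
    · rw [hα0 _ hz]; ring
    · rw [hγ0 _ hz]; ring
  · rintro z (hz | hz)
    · rw [hα1 _ hz]; ring
    · rw [hγ0 _ hz]; ring

theorem IsWeakGradient.ae_vertical_primitive (h : IsWeakGradient Ω u g) (hΩo : IsOpen Ω)
    (hD : IsOpen D) {c d : ℝ} (hcd : c < d) (hΩ : D ×ˢ Ioo c d ⊆ toPlane ⁻¹' Ω)
    (hu : IntegrableOn (fun p => u (toPlane p)) (D ×ˢ Ioo c d))
    (hg : IntegrableOn (fun p => g (toPlane p) 1) (D ×ˢ Ioo c d)) :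
    ∀ᵐ x ∂volume.restrict D, IntegrableOn (fun y => g (toPlane (x, y)) 1) (Ioo c d) ∧
      ∃ k : ℝ, ∀ᵐ y ∂volume.restrict (Ioo c d),
        u (toPlane (x, y)) = k + ∫ s in c..y, g (toPlane (x, s)) 1 := by
  rw [IntegrableOn, Measure.volume_eq_prod, ← Measure.prod_restrict] at hu hg
  exact ae_exists_ae_eq_primitive hD hcd (V := fun p => u (toPlane p))
    (G := fun p => g (toPlane p) 1) hu hg fun α γ h1 h2 h3 h4 h5 h6 =>
      h.integral_mul_deriv_snd hΩo hΩ h1 h2 h3 h4 h5 h6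

theorem IsWeakGradient.ae_horizontal_primitive (h : IsWeakGradient Ω u g) (hΩo : IsOpen Ω)
    (hI : IsOpen I) {a b : ℝ} (hab : a < b) (hΩ : Ioo a b ×ˢ I ⊆ toPlane ⁻¹' Ω)
    (hu : IntegrableOn (fun p => u (toPlane p)) (Ioo a b ×ˢ I))
    (hg : IntegrableOn (fun p => g (toPlane p) 0) (Ioo a b ×ˢ I)) :
    ∀ᵐ y ∂volume.restrict I, ∃ k : ℝ, ∀ᵐ x ∂volume.restrict (Ioo a b),
        u (toPlane (x, y)) = k + ∫ s in a..x, g (toPlane (s, y)) 0 := by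
  rw [IntegrableOn, Measure.volume_eq_prod, ← Measure.prod_restrict] at hu hg
  refine (ae_exists_ae_eq_primitive hI hab (V := fun p => u (toPlane p.swap))
    (G := fun p => g (toPlane p.swap) 0) hu.swap hg.swap fun α γ h1 h2 h3 h4 h5 h6 => ?_).mono
      fun y hy => hy.2
  have key := h.integral_mul_deriv_fst hΩo hΩ h4 h5 h6 h1 h2 h3
  rw [← integral_prod_swap, ← integral_prod_swap (fun z => g (toPlane z) 0 * _)] at key
  simpa only [Prod.fst_swap, Prod.snd_swap, mul_comm (α _)] using key

end WeakGradient

/-! ### Measurable representatives and Cauchy–Schwarz on subsets of the plane -/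

section SobolevPair

variable {Ω : Set (EuclideanSpace ℝ (Fin 2))} {u : EuclideanSpace ℝ (Fin 2) → ℝ}
  {g : EuclideanSpace ℝ (Fin 2) → EuclideanSpace ℝ (Fin 2)} {R : Set (ℝ × ℝ)}

/-- `u` is a measurable square integrable function on `Ω`, and `g` is its weak gradient, which is
measurable and square integrable. -/
structure IsSobolevPair (Ω : Set (EuclideanSpace ℝ (Fin 2))) (u : EuclideanSpace ℝ (Fin 2) → ℝ)
    (g : EuclideanSpace ℝ (Fin 2) → EuclideanSpace ℝ (Fin 2)) : Prop where
  measurable_fst : Measurable u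
  measurable_snd : Measurable g
  memLp_fst : MemLp u 2 (volume.restrict Ω)
  memLp_snd : MemLp g 2 (volume.restrict Ω)
  isWeakGradient : IsWeakGradient Ω u g

lemma IsSobolevPair.memLp_snd_apply (h : IsSobolevPair Ω u g) (i : Fin 2) :
    MemLp (fun z => g z i) 2 (volume.restrict Ω) :=
  h.memLp_snd.continuousLinearMap_comp
    (EuclideanSpace.proj i : EuclideanSpace ℝ (Fin 2) →L[ℝ] ℝ)

lemma IsSobolevPair.measurable_fst_toPlane (h : IsSobolevPair Ω u g) :
    Measurable fun p => u (toPlane p) :=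
  h.measurable_fst.comp continuous_toPlane.measurable

lemma IsSobolevPair.measurable_snd_toPlane (h : IsSobolevPair Ω u g) (i : Fin 2) :
    Measurable fun p => g (toPlane p) i :=
  (by fun_prop : Measurable fun z : EuclideanSpace ℝ (Fin 2) => z i).comp
    (h.measurable_snd.comp continuous_toPlane.measurable)

lemma memLp_comp_toPlane {f : EuclideanSpace ℝ (Fin 2) → ℝ} (hΩ : MeasurableSet Ω)
    (hf : MemLp f 2 (volume.restrict Ω)) (hR : R ⊆ toPlane ⁻¹' Ω) :
    MemLp (fun p => f (toPlane p)) 2 (volume.restrict R) :=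
  (hf.comp_measurePreserving (measurePreserving_toPlane_restrict hΩ)).mono_measure
    (Measure.restrict_mono hR le_rfl)

lemma integrableOn_comp_toPlane {f : EuclideanSpace ℝ (Fin 2) → ℝ} (hΩ : MeasurableSet Ω)
    (hf : MemLp f 2 (volume.restrict Ω)) (hR : R ⊆ toPlane ⁻¹' Ω)
    (hRf : volume R < ⊤) : IntegrableOn (fun p => f (toPlane p)) R := by
  have : IsFiniteMeasure (volume.restrict R) := ⟨by simpa using hRf⟩
  exact (memLp_comp_toPlane hΩ hf hR).integrable (by norm_num)

/-- Cauchy–Schwarz on R, after bounding a component by the norm of the whole gradient. -/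
lemma setIntegral_abs_le_sqrt_mul (hΩ : MeasurableSet Ω) (h : MemLp g 2 (volume.restrict Ω))
    {N : ℝ} (hN : eLpNorm g 2 (volume.restrict Ω) ≤ ENNReal.ofReal N) (hN0 : 0 ≤ N) (i : Fin 2)
    (hR : R ⊆ toPlane ⁻¹' Ω) (hRf : volume R < ⊤) :
    ∫ p in R, |g (toPlane p) i| ≤ √(volume.real R) * N := by
  have : IsFiniteMeasure (volume.restrict R) := ⟨by simpa using hRf⟩
  have hi : MemLp (fun z => g z i) 2 (volume.restrict Ω) := h.continuousLinearMap_comp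
    (EuclideanSpace.proj i : EuclideanSpace ℝ (Fin 2) →L[ℝ] ℝ)
  have hm := memLp_comp_toPlane hΩ hi hR
  have h1 : eLpNorm (fun p => g (toPlane p) i) 1 (volume.restrict R) ≤
      ENNReal.ofReal (√(volume.real R) * N) := by
    have hle := eLpNorm_le_eLpNorm_mul_rpow_measure_univ (p := 1) (q := 2) (by norm_num)
      hm.aestronglyMeasurable
    have h2 : eLpNorm (fun p => g (toPlane p) i) 2 (volume.restrict R) ≤ ENNReal.ofReal N := by
      calc eLpNorm (fun p => g (toPlane p) i) 2 (volume.restrict R)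
          ≤ eLpNorm (fun p => g (toPlane p)) 2 (volume.restrict R) :=
            eLpNorm_mono fun p => PiLp.norm_apply_le _ _
        _ ≤ eLpNorm (fun p => g (toPlane p)) 2 (volume.restrict (toPlane ⁻¹' Ω)) :=
            eLpNorm_mono_measure _ (Measure.restrict_mono hR le_rfl)
        _ = eLpNorm g 2 (volume.restrict Ω) :=
            eLpNorm_comp_measurePreserving h.aestronglyMeasurable
              (measurePreserving_toPlane_restrict hΩ)
        _ ≤ _ := hN
    refine hle.trans ?_
    rw [mul_comm (√_), ENNReal.ofReal_mul hN0]
    refine mul_le_mul' h2 ?_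
    rw [Measure.restrict_apply_univ, Real.sqrt_eq_rpow,
      ← ENNReal.ofReal_rpow_of_nonneg measureReal_nonneg (by norm_num), ofReal_measureReal hRf.ne]
    norm_num
  have h3 : ∫ p in R, |g (toPlane p) i| =
      (eLpNorm (fun p => g (toPlane p) i) 1 (volume.restrict R)).toReal := by
    rw [eLpNorm_one_eq_lintegral_enorm, ← integral_norm_eq_lintegral_enorm hm.aestronglyMeasurable]
    rfl
  rw [h3]
  exact ENNReal.toReal_le_of_le_ofReal (by positivity) h1

end SobolevPair

section H1

variable {Ω : Set (EuclideanSpace ℝ (Fin 2))}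

/-- A representative of the gradient of `u ∈ H¹(Ω)`. -/
def h1Grad (v : H1 Ω) : EuclideanSpace ℝ (Fin 2) → EuclideanSpace ℝ (Fin 2) := v.1.snd

lemma isSobolevPair_h1Rep (v : H1 Ω) : IsSobolevPair Ω (h1Rep v) (h1Grad v) where
  measurable_fst := (Lp.stronglyMeasurable v.1.fst).measurable
  measurable_snd := (Lp.stronglyMeasurable v.1.snd).measurable
  memLp_fst := Lp.memLp v.1.fst
  memLp_snd := Lp.memLp v.1.snd
  isWeakGradient := v.2

lemma eLpNorm_h1Grad_le (v : H1 Ω) :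
    eLpNorm (h1Grad v) 2 (volume.restrict Ω) ≤ ENNReal.ofReal ‖v‖ := by
  have h : ‖v.1.snd‖ ≤ ‖v‖ := by
    have h := WithLp.prod_norm_sq_eq_of_L2 v.1
    rw [Submodule.coe_norm]
    nlinarith [norm_nonneg v.1, norm_nonneg v.1.snd, sq_nonneg ‖v.1.fst‖]
  refine le_trans (le_of_eq ?_) (ENNReal.ofReal_le_ofReal h)
  rw [Lp.norm_def, ENNReal.ofReal_toReal (Lp.eLpNorm_ne_top _)]
  rfl

end H1

/-! ## Traces on horizontal lines -/

/-- The weight 1 - y vanishes at 1 and the primitive vanishes at s, so integration by parts gives ∫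
(1 - y) g = ∫ P without boundary terms; what remains is the mean of the constant k. The initial
value is thus recovered by an integral, with no choice of representative. -/
lemma integral_affine_weight_eq {s : ℝ} (hs : s < 1) {f g : ℝ → ℝ} {k : ℝ}
    (hg : IntegrableOn g (Ioo s 1))
    (h : ∀ᵐ y ∂volume.restrict (Ioo s 1), f y = k + ∫ t in s..y, g t) :
    ∫ y in Ioo s 1, ((1 - s)⁻¹ * f y - (1 - s)⁻¹ * (1 - y) * g y) = k := by
  have hgI : IntervalIntegrable g volume s 1 :=
    (intervalIntegrable_iff_integrableOn_Ioo_of_le hs.le).2 hg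
  have hP := hgI.absolutelyContinuousOnInterval_intervalIntegral (c := s) left_mem_uIcc
  set P : ℝ → ℝ := fun y => ∫ t in s..y, g t with hPdef
  have hPc : ContinuousOn P (uIcc s 1) := hP.continuousOn
  have hw : AbsolutelyContinuousOnInterval (fun y : ℝ => 1 - y) s 1 :=
    ContDiffOn.absolutelyContinuousOnInterval (by fun_prop)
  have ibp := hw.integral_mul_deriv_eq_deriv_mul hP
  have hPs : P s = 0 := by simp [hPdef]
  have hd : deriv (fun y : ℝ => 1 - y) = fun _ => -1 := by ext y; simp
  have e1 : ∫ x in s..1, (1 - x) * deriv P x = ∫ x in s..1, (1 - x) * g x := by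
    refine intervalIntegral.integral_congr_ae ?_
    filter_upwards [hgI.ae_hasDerivAt_integral] with y hy hy'
    rw [(hy (uIoc_subset_uIcc hy') s left_mem_uIcc).deriv]
  rw [e1, hPs, hd] at ibp
  simp only [neg_one_mul, intervalIntegral.integral_neg] at ibp
  have e2 : ∫ y in Ioo s 1, ((1 - s)⁻¹ * f y - (1 - s)⁻¹ * (1 - y) * g y) =
      ∫ y in s..1, (1 - s)⁻¹ * (k + P y - (1 - y) * g y) := by
    rw [intervalIntegral.integral_of_le hs.le, integral_Ioc_eq_integral_Ioo]
    refine integral_congr_ae ?_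
    filter_upwards [h] with y hy
    rw [hy]; ring
  have hPi : IntervalIntegrable P volume s 1 := hPc.intervalIntegrable
  have hwg : IntervalIntegrable (fun y => (1 - y) * g y) volume s 1 :=
    hgI.continuousOn_mul (by fun_prop)
  rw [e2, intervalIntegral.integral_const_mul, intervalIntegral.integral_sub
    (intervalIntegrable_const.add hPi) hwg, intervalIntegral.integral_add intervalIntegrable_const hPi,
    intervalIntegral.integral_const, ibp]
  have : 1 - s ≠ 0 := by linarith
  simp only [smul_eq_mul]
  field_simp
  ring

/-- The value at the height `s` of the primitive of `g₂` on `(s, 1)` that coincides with `u`. -/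
def heightTrace (u : EuclideanSpace ℝ (Fin 2) → ℝ)
    (g : EuclideanSpace ℝ (Fin 2) → EuclideanSpace ℝ (Fin 2)) (s x : ℝ) : ℝ :=
  ∫ y in Ioo s 1, ((1 - s)⁻¹ * u (toPlane (x, y)) -
    (1 - s)⁻¹ * (1 - y) * g (toPlane (x, y)) 1)

section

variable {u : EuclideanSpace ℝ (Fin 2) → ℝ}
  {g : EuclideanSpace ℝ (Fin 2) → EuclideanSpace ℝ (Fin 2)}

lemma measurableSet_biconeDomain : MeasurableSet biconeDomain := isOpen_biconeDomain.measurableSet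

lemma cantorThickening_prod_subset (s : ℝ) :
    cantorThickening s ×ˢ Ioo s 1 ⊆ toPlane ⁻¹' biconeDomain := fun _ hp =>
  mem_biconeDomain_of_mem_cantorThickening hp.1 hp.2.1.le hp.2.2

lemma volume_cantorThickening_prod_lt_top (s c d : ℝ) :
    volume (cantorThickening s ×ˢ Ioo c d) < ⊤ := by
  rw [Measure.volume_eq_prod, Measure.prod_prod]
  exact ENNReal.mul_lt_top ((measure_mono (cantorThickening_subset s)).trans_lt (by simp)) (by simp)

lemma IsSobolevPair.integrableOn_fst (h : IsSobolevPair biconeDomain u g) {R : Set (ℝ × ℝ)}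
    (hR : R ⊆ toPlane ⁻¹' biconeDomain) (hRf : volume R < ⊤) :
    IntegrableOn (fun p => u (toPlane p)) R :=
  integrableOn_comp_toPlane measurableSet_biconeDomain h.memLp_fst hR hRf

lemma IsSobolevPair.integrableOn_snd (h : IsSobolevPair biconeDomain u g) (i : Fin 2) {R : Set (ℝ × ℝ)}
    (hR : R ⊆ toPlane ⁻¹' biconeDomain) (hRf : volume R < ⊤) :
    IntegrableOn (fun p => g (toPlane p) i) R :=
  integrableOn_comp_toPlane measurableSet_biconeDomain (h.memLp_snd_apply i) hR hRf

lemma ae_eq_heightTrace_add (h : IsSobolevPair biconeDomain u g) {s : ℝ} (hs : s < 1) :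
    ∀ᵐ x ∂volume.restrict (cantorThickening s),
      IntegrableOn (fun y => g (toPlane (x, y)) 1) (Ioo s 1) ∧
      ∀ᵐ y ∂volume.restrict (Ioo s 1), u (toPlane (x, y)) =
        heightTrace u g s x + ∫ t in s..y, g (toPlane (x, t)) 1 := by
  have hsub := cantorThickening_prod_subset s
  have hfin := volume_cantorThickening_prod_lt_top s s 1
  filter_upwards [h.isWeakGradient.ae_vertical_primitive isOpen_biconeDomain
    (isOpen_cantorThickening s) hs hsub (IsSobolevPair.integrableOn_fst h hsub hfin)
    (IsSobolevPair.integrableOn_snd h 1 hsub hfin)] with x hx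
  obtain ⟨hg, k, hk⟩ := hx
  refine ⟨hg, ?_⟩
  rw [heightTrace, integral_affine_weight_eq hs hg hk]
  exact hk

lemma integrableOn_affine_weight (h : IsSobolevPair biconeDomain u g) (s : ℝ) :
    Integrable (fun p => (1 - s)⁻¹ * u (toPlane p) -
      (1 - s)⁻¹ * (1 - p.2) * g (toPlane p) 1)
      ((volume.restrict (cantorThickening s)).prod (volume.restrict (Ioo s 1))) := by
  have hsub := cantorThickening_prod_subset s
  have hfin := volume_cantorThickening_prod_lt_top s s 1
  have h1 := IsSobolevPair.integrableOn_fst h hsub hfin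
  have h2 := IsSobolevPair.integrableOn_snd h 1 hsub hfin
  have h3 : IntegrableOn (fun p : ℝ × ℝ => (1 - s)⁻¹ * (1 - p.2) * g (toPlane p) 1)
      (cantorThickening s ×ˢ Ioo s 1) := by
    refine Integrable.bdd_mul (c := |(1 - s)⁻¹| * |1 - s|) h2 (by fun_prop) ?_
    filter_upwards [ae_restrict_mem ((isOpen_cantorThickening s).measurableSet.prod
      measurableSet_Ioo)] with p hp
    rw [norm_mul, Real.norm_eq_abs, Real.norm_eq_abs]
    gcongr 2
    · exact (sub_pos.2 hp.2.2).le
    · exact sub_le_sub_left hp.2.1.le 1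
  rw [Measure.prod_restrict, ← Measure.volume_eq_prod]
  exact (h1.const_mul _).sub h3

lemma integrableOn_heightTrace (h : IsSobolevPair biconeDomain u g) (s : ℝ) :
    IntegrableOn (heightTrace u g s) (cantorThickening s) :=
  (integrableOn_affine_weight h s).integral_prod_left

/-- The formula at height c sees only the points above c, whereas the limit is two-sided. A point x
of the open neighbourhood of radius c already belongs to one of smaller radius s_m, so the primitive
starting at s_m is available and is continuous across c. The two representations are matched at one
common height above c. -/
lemma isHorizontalTrace_heightTrace (h : IsSobolevPair biconeDomain u g) {c : ℝ} (hc0 : 0 < c) (hc : c < 1) :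
    IsHorizontalTrace u c (cantorThickening c) (heightTrace u g c) := by
  set s : ℕ → ℝ := fun m => c - c * (1 / ((m : ℝ) + 1)) with hs
  have hsc (m : ℕ) : s m < c := by
    have : 0 < c * (1 / ((m : ℝ) + 1)) := by positivity
    simp only [hs]; linarith
  have hlim : Tendsto s atTop (𝓝 c) := by
    have := (tendsto_one_div_add_atTop_nhds_zero_nat (𝕜 := ℝ)).const_mul c
    simpa [hs] using this.const_sub c
  have hall : ∀ᵐ x, ∀ m : ℕ, x ∈ cantorThickening (s m) →
      IntegrableOn (fun y => g (toPlane (x, y)) 1) (Ioo (s m) 1) ∧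
      ∀ᵐ y ∂volume.restrict (Ioo (s m) 1), u (toPlane (x, y)) =
        heightTrace u g (s m) x + ∫ t in (s m)..y, g (toPlane (x, t)) 1 :=
    ae_all_iff.2 fun m => (ae_restrict_iff' (isOpen_cantorThickening _).measurableSet).1
      (ae_eq_heightTrace_add h ((hsc m).trans hc))
  have hmeas := (isOpen_cantorThickening c).measurableSet
  rw [IsHorizontalTrace]
  filter_upwards [ae_eq_heightTrace_add h hc, ae_restrict_of_ae hall, ae_restrict_mem hmeas]
    with x hx hxall hxc
  obtain ⟨a, ha, hxa⟩ := hxc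
  obtain ⟨m, hm⟩ := (hlim.eventually (lt_mem_nhds hxa)).exists
  obtain ⟨hgi, hrep⟩ := hxall m ⟨a, ha, hm⟩
  set G : ℝ → ℝ := fun y => g (toPlane (x, y)) 1 with hG
  have hsm1 := (hsc m).trans hc
  have hgI : IntervalIntegrable G volume (s m) 1 :=
    (intervalIntegrable_iff_integrableOn_Ioo_of_le hsm1.le).2 hgi
  have hPc : ContinuousOn (fun y => ∫ t in (s m)..y, G t) (uIcc (s m) 1) :=
    intervalIntegral.continuousOn_primitive_interval
      ((intervalIntegrable_iff_integrableOn_Icc_of_le hsm1.le).1 hgI |>.mono_set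
        (by rw [uIcc_of_le hsm1.le]))
  have hcat : ContinuousAt (fun y => heightTrace u g (s m) x + ∫ t in (s m)..y, G t) c :=
    continuousAt_const.add (hPc.continuousAt (by
      rw [uIcc_of_le hsm1.le]; exact Icc_mem_nhds (hsc m) hc))
  have heq : heightTrace u g (s m) x + ∫ t in (s m)..c, G t = heightTrace u g c x := by
    have hsub : Ioo c 1 ⊆ Ioo (s m) 1 := Ioo_subset_Ioo_left (hsc m).le
    have hne : (volume.restrict (Ioo c 1)) ≠ 0 := by
      rw [Ne, Measure.restrict_eq_zero]; simp [hc]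
    have : NeZero (volume.restrict (Ioo c 1)) := ⟨hne⟩
    obtain ⟨y, hy1, hy2, hy⟩ := ((ae_restrict_of_ae_restrict_of_subset hsub hrep).and
      (hx.2.and (ae_restrict_mem measurableSet_Ioo))).exists
    have hsplit : (∫ t in (s m)..c, G t) + ∫ t in c..y, G t = ∫ t in (s m)..y, G t :=
      intervalIntegral.integral_add_adjacent_intervals
        (hgI.mono_set (uIcc_subset_uIcc left_mem_uIcc
          (by rw [uIcc_of_le hsm1.le]; exact ⟨(hsc m).le, hc.le⟩)))
        (hgI.mono_set (uIcc_subset_uIcc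
          (by rw [uIcc_of_le hsm1.le]; exact ⟨(hsc m).le, hc.le⟩)
          (by rw [uIcc_of_le hsm1.le]; exact ⟨((hsc m).trans hy.1).le, hy.2.le⟩)))
    rw [hy1] at hy2
    simp only [hG] at hsplit ⊢
    linarith
  rw [← heq]
  refine (hcat.tendsto.mono_left inf_le_left).congr' ?_
  rw [ae_restrict_iff' measurableSet_Ioo] at hrep
  filter_upwards [mem_inf_of_left (Ioo_mem_nhds (hsc m) hc), mem_inf_of_right hrep] with y hy1 hy2
  exact (hy2 hy1).symm

/-! ### Averaged traces as continuous linear forms -/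

lemma isFiniteMeasure_restrict_biconeDomain :
    IsFiniteMeasure ((volume : Measure (EuclideanSpace ℝ (Fin 2))).restrict biconeDomain) :=
  ⟨by simpa using isBounded_biconeDomain.measure_lt_top⟩

/-- The form is the inner product with the fixed element (a, b e₂) of L² × L², restricted to H¹,
hence continuous. -/
lemma exists_continuousLinearMap_integral {Ω : Set (EuclideanSpace ℝ (Fin 2))}
    [IsFiniteMeasure (volume.restrict Ω)] {a b : EuclideanSpace ℝ (Fin 2) → ℝ} {C : ℝ}
    (ha : Measurable a) (hb : Measurable b) (haC : ∀ z, |a z| ≤ C) (hbC : ∀ z, |b z| ≤ C) :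
    ∃ L : H1 Ω →L[ℝ] ℝ, ∀ v, L v = ∫ z in Ω, (a z * h1Rep v z + b z * h1Grad v z 1) := by
  have ha2 : MemLp a 2 (volume.restrict Ω) :=
    MemLp.of_bound ha.aestronglyMeasurable C (ae_of_all _ haC)
  have hb2 : MemLp b 2 (volume.restrict Ω) :=
    MemLp.of_bound hb.aestronglyMeasurable C (ae_of_all _ hbC)
  have hB2 : MemLp (fun z => b z • (EuclideanSpace.single 1 1 : EuclideanSpace ℝ (Fin 2))) 2
      (volume.restrict Ω) := by
    refine MemLp.of_bound (hb.aestronglyMeasurable.smul_const _) C (ae_of_all _ fun z => ?_)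
    rw [norm_smul]
    simpa using hbC z
  refine ⟨(innerSL ℝ (WithLp.toLp 2 (ha2.toLp a, hB2.toLp _))).comp (H1 Ω).subtypeL, fun v => ?_⟩
  have h1 : ⟪ha2.toLp a, v.1.fst⟫ = ∫ z in Ω, a z * h1Rep v z := by
    rw [L2.inner_def]
    refine integral_congr_ae ?_
    filter_upwards [ha2.coeFn_toLp] with z hz
    rw [hz]; simp [h1Rep, mul_comm]
  have h2 : ⟪hB2.toLp _, v.1.snd⟫ = ∫ z in Ω, b z * h1Grad v z 1 := by
    rw [L2.inner_def]
    refine integral_congr_ae ?_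
    filter_upwards [hB2.coeFn_toLp] with z hz
    rw [hz, real_inner_smul_left, EuclideanSpace.inner_single_left]; simp [h1Grad]
  have h3 : ∫ z in Ω, (a z * h1Rep v z + b z * h1Grad v z 1) = _ :=
    integral_add (ha2.integrable_mul (isSobolevPair_h1Rep v).memLp_fst) (hb2.integrable_mul ((isSobolevPair_h1Rep v).memLp_snd_apply 1))
  refine Eq.trans ?_ (h3.trans (congrArg₂ (· + ·) h1.symm h2.symm)).symm
  exact WithLp.prod_inner_apply _ _

/-- The part of the plane that lies over the `s`-neighbourhood of the Cantor set, at heights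
between `s` and `1`. -/
def heightRectangle (s : ℝ) : Set (EuclideanSpace ℝ (Fin 2)) :=
  {z | z 0 ∈ cantorThickening s} ∩ {z | z 1 ∈ Ioo s 1}

lemma mem_heightRectangle {s : ℝ} {z : EuclideanSpace ℝ (Fin 2)} :
    z ∈ heightRectangle s ↔ z 0 ∈ cantorThickening s ∧ z 1 ∈ Ioo s 1 := Iff.rfl

lemma measurableSet_heightRectangle (s : ℝ) : MeasurableSet (heightRectangle s) := by
  have h0 : Measurable fun z : EuclideanSpace ℝ (Fin 2) => z 0 := by fun_prop
  have h1 : Measurable fun z : EuclideanSpace ℝ (Fin 2) => z 1 := by fun_prop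
  exact (h0 (isOpen_cantorThickening s).measurableSet).inter (h1 measurableSet_Ioo)

lemma setIntegral_heightRectangle_eq (h : IsSobolevPair biconeDomain u g) (s : ℝ) :
    ∫ z in biconeDomain,
      ((heightRectangle s).indicator
          (fun _ => (volume.real (cantorThickening s))⁻¹ * (1 - s)⁻¹) z * u z +
        (heightRectangle s).indicator
          (fun z => (volume.real (cantorThickening s))⁻¹ * (1 - s)⁻¹ * -(1 - z 1)) z * g z 1) =
      (volume.real (cantorThickening s))⁻¹ * ∫ x in cantorThickening s, heightTrace u g s x := by
  have hi := integrableOn_affine_weight h s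
  rw [setIntegral_eq_integral_prod isOpen_biconeDomain (cantorThickening_prod_subset s)]
  · simp only [heightTrace]
    rw [← integral_prod (fun p : ℝ × ℝ => (1 - s)⁻¹ * u (toPlane p) -
      (1 - s)⁻¹ * (1 - p.2) * g (toPlane p) 1) hi, ← integral_const_mul]
    rw [Measure.prod_restrict]
    refine setIntegral_congr_fun ((isOpen_cantorThickening s).measurableSet.prod
      measurableSet_Ioo) fun p hp => ?_
    have hpR : toPlane p ∈ heightRectangle s := by
      rw [mem_heightRectangle, toPlane_zero, toPlane_one]; exact hp
    simp only
    rw [indicator_of_mem hpR, indicator_of_mem hpR, toPlane_one]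
    ring
  · intro z hz
    have hzR : z ∉ heightRectangle s := by
      rw [mem_heightRectangle]
      rintro ⟨h0, h1⟩
      exact hz.elim (· h0) (· h1)
    rw [indicator_of_notMem hzR, indicator_of_notMem hzR]; ring

end

lemma abs_indicator_heightRectangle_le {s : ℝ} (hs0 : 0 < s) (κ : ℝ)
    (z : EuclideanSpace ℝ (Fin 2)) :
    |(heightRectangle s).indicator (fun z => κ * -(1 - z 1)) z| ≤ |κ| := by
  by_cases hz : z ∈ heightRectangle s
  · rw [indicator_of_mem hz, abs_mul, abs_neg]
    have hz' := (mem_heightRectangle.1 hz).2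
    exact mul_le_of_le_one_right (abs_nonneg _)
      (abs_le.2 ⟨by linarith [hz'.1, hz'.2], by linarith [hz'.1, hz'.2]⟩)
  · rw [indicator_of_notMem hz]; simp

lemma exists_heightForm {s : ℝ} (hs0 : 0 < s) : ∃ L : H1 biconeDomain →L[ℝ] ℝ,
    ∀ v, L v = (volume.real (cantorThickening s))⁻¹ *
      ∫ x in cantorThickening s, heightTrace (h1Rep v) (h1Grad v) s x :=
  have := isFiniteMeasure_restrict_biconeDomain
  have hb : Measurable fun z : EuclideanSpace ℝ (Fin 2) =>
    (volume.real (cantorThickening s))⁻¹ * (1 - s)⁻¹ * -(1 - z 1) := by fun_prop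
  (exists_continuousLinearMap_integral
    (measurable_const.indicator (measurableSet_heightRectangle s))
    (hb.indicator (measurableSet_heightRectangle s))
    (fun z => by
      by_cases hz : z ∈ heightRectangle s
      · rw [indicator_of_mem hz]
      · rw [indicator_of_notMem hz, abs_zero]; exact abs_nonneg _)
    (abs_indicator_heightRectangle_le hs0 _)).imp fun _ hL v =>
      (hL v).trans (setIntegral_heightRectangle_eq (isSobolevPair_h1Rep v) s)

lemma exists_lineForm (n : ℕ) : ∃ L : H1 biconeDomain →L[ℝ] ℝ,
    ∀ v, L v = lineAverage n (heightTrace (h1Rep v) (h1Grad v) (lineHeight n)) := by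
  simp only [lineAverage, lineDomain_eq]
  exact exists_heightForm (lineHeight_pos n)

/-- The linear form `v ↦ |D_n|⁻¹ ∫_{D_n} v(x, y_n) dx` on `H¹(Ω)`. -/
def lineForm (n : ℕ) : H1 biconeDomain →L[ℝ] ℝ := (exists_lineForm n).choose

lemma lineForm_apply (n : ℕ) (v : H1 biconeDomain) :
    lineForm n v = lineAverage n (heightTrace (h1Rep v) (h1Grad v) (lineHeight n)) := (exists_lineForm n).choose_spec v

lemma isHorizontalTrace_lineHeight (n : ℕ) (v : H1 biconeDomain) :
    IsHorizontalTrace (h1Rep v) (lineHeight n) (lineDomain n)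
      (heightTrace (h1Rep v) (h1Grad v) (lineHeight n)) := by
  rw [lineDomain_eq]
  exact isHorizontalTrace_heightTrace (isSobolevPair_h1Rep v) (lineHeight_pos n)
    ((lineHeight_le n).trans_lt (by norm_num))

lemma isHorizontalAverage_lineForm (n : ℕ) :
    IsHorizontalAverage biconeDomain (lineHeight n) (lineDomain n) (lineForm n) := fun v =>
  ⟨_, isHorizontalTrace_lineHeight n v, by rw [lineDomain_eq]; exact integrableOn_heightTrace (isSobolevPair_h1Rep v) _,
    lineForm_apply n v⟩

/-! ## Convergence of the averages -/

section

variable {u : EuclideanSpace ℝ (Fin 2) → ℝ}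
  {g : EuclideanSpace ℝ (Fin 2) → EuclideanSpace ℝ (Fin 2)}

lemma measurable_heightTrace (h : IsSobolevPair biconeDomain u g) (s : ℝ) : Measurable (heightTrace u g s) := by
  have h1 := h.measurable_fst_toPlane
  have h2 := h.measurable_snd_toPlane 1
  have h3 : StronglyMeasurable fun p : ℝ × ℝ => (1 - s)⁻¹ * u (toPlane p) -
      (1 - s)⁻¹ * (1 - p.2) * g (toPlane p) 1 :=
    ((measurable_const.mul h1).sub ((by fun_prop : Measurable fun p : ℝ × ℝ =>
      (1 - s)⁻¹ * (1 - p.2)).mul h2)).stronglyMeasurable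
  exact (h3.integral_prod_right (ν := volume.restrict (Ioo s 1))).measurable

lemma lineDomain_prod_subset {n : ℕ} {c d : ℝ} (hc : lineHeight n ≤ c) (hd : d ≤ 1) :
    lineDomain n ×ˢ Ioo c d ⊆ toPlane ⁻¹' biconeDomain := by
  rw [lineDomain_eq]
  exact (prod_mono_right (Ioo_subset_Ioo hc hd)).trans (cantorThickening_prod_subset _)

lemma volume_lineDomain_prod_lt_top (n : ℕ) (c d : ℝ) :
    volume (lineDomain n ×ˢ Ioo c d) < ⊤ := by
  rw [Measure.volume_eq_prod, Measure.prod_prod]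
  exact ENNReal.mul_lt_top (volume_lineDomain_lt_top n) (by simp)

lemma volume_real_lineDomain_prod (n : ℕ) {c d : ℝ} (hcd : c ≤ d) :
    volume.real (lineDomain n ×ˢ Ioo c d) = 2 * (2 / 3) ^ n * (d - c) := by
  rw [Measure.volume_eq_prod, measureReal_prod_prod, volume_real_lineDomain]
  simp [Measure.real, hcd]

lemma integrable_lineDomain_prod {f : ℝ × ℝ → ℝ} {n : ℕ} {c d : ℝ}
    (hf : IntegrableOn f (lineDomain n ×ˢ Ioo c d)) :
    Integrable f ((volume.restrict (lineDomain n)).prod (volume.restrict (Ioo c d))) := by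
  rwa [Measure.prod_restrict, ← Measure.volume_eq_prod]

/-- The vertical transport. On almost every vertical segment the trace and the value at height y
differ by at most the integral of |∂₂u|; this is then averaged over the base. -/
lemma abs_heightTraceAverage_sub_lineAverage_le (h : IsSobolevPair biconeDomain u g) (n : ℕ) {c d : ℝ}
    (hc : lineHeight n ≤ c) (hd : d ≤ 1) :
    ∀ᵐ y ∂volume.restrict (Ioo c d),
      |lineAverage n (heightTrace u g (lineHeight n)) - lineAverage n (fun x => u (toPlane (x, y)))| ≤
        (volume.real (lineDomain n))⁻¹ *
          ∫ p in lineDomain n ×ˢ Ioo (lineHeight n) d, |g (toPlane p) 1| := by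
  set s := lineHeight n with hs
  have hs1 : s < 1 := (lineHeight_le n).trans_lt (by norm_num)
  set H : ℝ → ℝ := fun x => ∫ t in Ioo s d, |g (toPlane (x, t)) 1| with hH
  have hHm : Measurable H := by
    have h2 := h.measurable_snd_toPlane 1
    have h3 : StronglyMeasurable fun p : ℝ × ℝ => |g (toPlane p) 1| :=
      Measurable.stronglyMeasurable (by simpa only [Real.norm_eq_abs] using h2.norm)
    exact (h3.integral_prod_right (ν := volume.restrict (Ioo s d))).measurable
  have hGi : Integrable (fun p => |g (toPlane p) 1|)
      ((volume.restrict (lineDomain n)).prod (volume.restrict (Ioo s d))) :=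
    integrable_lineDomain_prod (h.integrableOn_snd 1
      (lineDomain_prod_subset le_rfl hd) (volume_lineDomain_prod_lt_top n _ _)).abs
  have hxy : ∀ᵐ x ∂volume.restrict (lineDomain n), ∀ᵐ y ∂volume.restrict (Ioo c d),
      |heightTrace u g s x - u (toPlane (x, y))| ≤ H x := by
    have := ae_eq_heightTrace_add h hs1
    rw [← lineDomain_eq] at this
    filter_upwards [this] with x hx
    obtain ⟨hg, hx⟩ := hx
    filter_upwards [ae_restrict_of_ae_restrict_of_subset (Ioo_subset_Ioo hc hd) hx,
      ae_restrict_mem measurableSet_Ioo] with y hy hycd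
    have hsy : s ≤ y := hc.trans hycd.1.le
    rw [hy, sub_add_cancel_left, abs_neg]
    refine (intervalIntegral.abs_integral_le_integral_abs hsy).trans ?_
    rw [intervalIntegral.integral_of_le hsy]
    refine setIntegral_mono_set (hg.mono_set (Ioo_subset_Ioo_right hd)).abs
      (ae_of_all _ fun _ => abs_nonneg _) (LE.le.eventuallyLE ?_)
    exact fun t ht => ⟨ht.1, ht.2.trans_lt hycd.2⟩
  -- Measurability of this set is needed to exchange "for almost all x, for almost all y". It rests
  -- on the integral formula for the trace.
  have hmeas : MeasurableSet {p : ℝ × ℝ | |heightTrace u g s p.1 - u (toPlane (p.1, p.2))| ≤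
      H p.1} := by
    have h1 : Measurable fun p : ℝ × ℝ => heightTrace u g s p.1 - u (toPlane (p.1, p.2)) :=
      ((measurable_heightTrace h s).comp measurable_fst).sub (h.measurable_fst_toPlane)
    exact measurableSet_le (by simpa only [Real.norm_eq_abs] using h1.norm)
      (hHm.comp measurable_fst)
  have hVi : Integrable (fun p => u (toPlane p))
      ((volume.restrict (lineDomain n)).prod (volume.restrict (Ioo c d))) :=
    integrable_lineDomain_prod (h.integrableOn_fst
      (lineDomain_prod_subset hc hd) (volume_lineDomain_prod_lt_top n _ _))
  have hT : IntegrableOn (heightTrace u g s) (lineDomain n) := by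
    rw [lineDomain_eq]; exact integrableOn_heightTrace h s
  filter_upwards [(Measure.ae_ae_comm hmeas).1 hxy, hVi.prod_left_ae] with y hy hyi
  rw [← lineAverage_sub hT hyi]
  refine (abs_lineAverage_le_integral _ _).trans ?_
  gcongr
  rw [Measure.volume_eq_prod, ← Measure.prod_restrict, integral_prod _ hGi]
  exact integral_mono_ae (hT.sub hyi).abs hGi.integral_prod_left hy

/-- The restriction to rational endpoints in `IsPrimitiveOn` makes this a countable intersection of
almost-everywhere statements in y. -/
lemma IsSobolevPair.ae_isPrimitiveOn (h : IsSobolevPair biconeDomain u g) (n : ℕ) {c d : ℝ}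
    (hc : lineHeight n ≤ c) (hd : d ≤ 1) :
    ∀ᵐ y ∂volume.restrict (Ioo c d), IsPrimitiveOn (lineDomain n)
      (fun x => u (toPlane (x, y))) (fun x => g (toPlane (x, y)) 0) := by
  simp only [IsPrimitiveOn, ae_all_iff]
  intro a b hab hsub
  have hR := (prod_mono_left hsub).trans (lineDomain_prod_subset (n := n) hc hd)
  have hf : volume (Ioo (a : ℝ) b ×ˢ Ioo c d) < ⊤ :=
    (measure_mono (prod_mono_left hsub)).trans_lt (volume_lineDomain_prod_lt_top n c d)
  exact h.isWeakGradient.ae_horizontal_primitive isOpen_biconeDomain isOpen_Ioo hab hR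
    (h.integrableOn_fst hR hf) (h.integrableOn_snd 0 hR hf)

/-- The first two terms are the vertical transports to a height y in (y_n, 2y_n), the third the
horizontal comparison there. Since the latter involves the derivative on a single line, the
inequality is averaged over y, which produces the factor 1/y_n and an area integral. -/
lemma abs_heightTraceAverage_sub_succ_le_integral (h : IsSobolevPair biconeDomain u g) (n : ℕ) :
    |lineAverage n (heightTrace u g (lineHeight n)) - lineAverage (n + 1) (heightTrace u g (lineHeight (n + 1)))| ≤
      (volume.real (lineDomain n))⁻¹ *
        (∫ p in lineDomain n ×ˢ Ioo (lineHeight n) (2 * lineHeight n), |g (toPlane p) 1|) +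
      (volume.real (lineDomain (n + 1)))⁻¹ *
        (∫ p in lineDomain (n + 1) ×ˢ Ioo (lineHeight (n + 1)) (2 * lineHeight n),
          |g (toPlane p) 1|) +
      (lineHeight n)⁻¹ * (2 * (1 / 2) ^ n *
        ∫ p in lineDomain n ×ˢ Ioo (lineHeight n) (2 * lineHeight n), |g (toPlane p) 0|) := by
  have hs0 := lineHeight_pos n
  have hs2 : 2 * lineHeight n ≤ 1 := by linarith [lineHeight_le n]
  have hs3 : lineHeight (n + 1) ≤ lineHeight n := by rw [lineHeight_succ]; linarith
  set s := lineHeight n with hs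
  have hsub := lineDomain_prod_subset (n := n) (c := s) le_rfl hs2
  have hfin := volume_lineDomain_prod_lt_top n s (2 * s)
  have hVi := integrable_lineDomain_prod (h.integrableOn_fst hsub hfin)
  have hGi := integrable_lineDomain_prod (h.integrableOn_snd 0 hsub hfin)
  set K₁ := (volume.real (lineDomain n))⁻¹ *
    ∫ p in lineDomain n ×ˢ Ioo s (2 * s), |g (toPlane p) 1|
  set K₂ := (volume.real (lineDomain (n + 1)))⁻¹ *
    ∫ p in lineDomain (n + 1) ×ˢ Ioo (lineHeight (n + 1)) (2 * s), |g (toPlane p) 1|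
  have hae : ∀ᵐ y ∂volume.restrict (Ioo s (2 * s)), |lineAverage n (heightTrace u g (lineHeight n)) - lineAverage (n + 1) (heightTrace u g (lineHeight (n + 1)))| ≤
      K₁ + K₂ + 2 * (1 / 2) ^ n * ∫ x in lineDomain n, |g (toPlane (x, y)) 0| := by
    filter_upwards [abs_heightTraceAverage_sub_lineAverage_le h n (c := s) le_rfl hs2,
      abs_heightTraceAverage_sub_lineAverage_le h (n + 1) hs3 hs2,
      IsSobolevPair.ae_isPrimitiveOn h n (c := s) le_rfl hs2, hVi.prod_left_ae, hGi.prod_left_ae]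
      with y h1 h2 h3 h4 h5
    have h6 := abs_lineAverage_sub_succ_le n h4 h5 h3
    rw [abs_le] at *
    constructor <;> linarith
  have hint : Integrable (fun y => ∫ x in lineDomain n, |g (toPlane (x, y)) 0|)
      (volume.restrict (Ioo s (2 * s))) := hGi.abs.integral_prod_right
  have hK : Integrable (fun _ : ℝ => K₁ + K₂) (volume.restrict (Ioo s (2 * s))) :=
    integrable_const _
  have hmono := integral_mono_ae (integrable_const _) (hK.add (hint.const_mul _)) hae
  have hvol : volume.real (Ioo s (2 * s)) = s := by
    rw [Real.volume_real_Ioo_of_le (by linarith)]; ring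
  have e1 : ∫ y in Ioo s (2 * s), (K₁ + K₂ + 2 * (1 / 2) ^ n *
      ∫ x in lineDomain n, |g (toPlane (x, y)) 0|) = s * (K₁ + K₂) + 2 * (1 / 2) ^ n *
        ∫ p in lineDomain n ×ˢ Ioo s (2 * s), |g (toPlane p) 0| := by
    rw [integral_add hK (hint.const_mul _), setIntegral_const, hvol, integral_const_mul,
      smul_eq_mul, Measure.volume_eq_prod, ← Measure.prod_restrict, integral_prod_symm _ hGi.abs]
  rw [setIntegral_const, hvol, smul_eq_mul] at hmono
  have h7 := hmono.trans_eq e1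
  rw [← sub_le_iff_le_add', le_inv_mul_iff₀ hs0]
  linarith

/-- With ρ = (√2/3)ⁿ, the areas involved are ρ² and (10/9)ρ² ≤ (2ρ)², and each prefactor is a
multiple of (3/2)ⁿ. The constants add up to 1/2 + (3/4) · 2 + 4 = 6. -/
lemma abs_heightTraceAverage_sub_succ_le (h : IsSobolevPair biconeDomain u g) {N : ℝ} (hv : 0 ≤ N)
    (hN : eLpNorm g 2 (volume.restrict biconeDomain) ≤ ENNReal.ofReal N) (n : ℕ) :
    |lineAverage n (heightTrace u g (lineHeight n)) -
      lineAverage (n + 1) (heightTrace u g (lineHeight (n + 1)))| ≤ 6 * (√2 / 2) ^ n * N := by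
  have hs0 := lineHeight_pos n
  have hs2 : 2 * lineHeight n ≤ 1 := by linarith [lineHeight_le n]
  have hs3 : lineHeight (n + 1) ≤ 2 * lineHeight n := by rw [lineHeight_succ]; linarith
  have hsub := lineDomain_prod_subset (n := n) (c := lineHeight n) le_rfl hs2
  have hfin := volume_lineDomain_prod_lt_top n (lineHeight n) (2 * lineHeight n)
  have b0 := setIntegral_abs_le_sqrt_mul measurableSet_biconeDomain h.memLp_snd hN hv 0 hsub hfin
  have b1 := setIntegral_abs_le_sqrt_mul measurableSet_biconeDomain h.memLp_snd hN hv 1 hsub hfin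
  have b2 := setIntegral_abs_le_sqrt_mul measurableSet_biconeDomain h.memLp_snd hN hv 1
    (lineDomain_prod_subset (n := n + 1) (c := lineHeight (n + 1)) le_rfl hs2)
    (volume_lineDomain_prod_lt_top (n + 1) (lineHeight (n + 1)) (2 * lineHeight n))
  set ρ : ℝ := (√2 / 3) ^ n with hρ
  have hρ2 : ρ ^ 2 = (2 / 3) ^ n * (3⁻¹) ^ n := by
    rw [hρ, ← pow_mul, mul_comm n 2, pow_mul, div_pow, Real.sq_sqrt (by norm_num), ← mul_pow]
    norm_num
  have v1 : √(volume.real (lineDomain n ×ˢ Ioo (lineHeight n) (2 * lineHeight n))) ≤ ρ := by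
    rw [volume_real_lineDomain_prod n (by linarith)]
    refine Real.sqrt_le_iff.2 ⟨by positivity, le_of_eq ?_⟩
    rw [hρ2, lineHeight]; ring
  have v2 : √(volume.real (lineDomain (n + 1) ×ˢ Ioo (lineHeight (n + 1)) (2 * lineHeight n))) ≤
      2 * ρ := by
    rw [volume_real_lineDomain_prod (n + 1) hs3]
    refine Real.sqrt_le_iff.2 ⟨by positivity, ?_⟩
    rw [mul_pow, hρ2, lineHeight_succ, lineHeight, pow_succ]
    have : 0 ≤ (2 / 3 : ℝ) ^ n * (3⁻¹) ^ n := by positivity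
    nlinarith
  have hpow : (√2 / 2) ^ n = (3 / 2) ^ n * ρ := by
    rw [hρ, ← mul_pow]; congr 1; ring
  have i1 : (volume.real (lineDomain n))⁻¹ = 1 / 2 * (3 / 2) ^ n := by
    rw [volume_real_lineDomain, mul_inv, ← inv_pow]; norm_num
  have i2 : (volume.real (lineDomain (n + 1)))⁻¹ = 3 / 4 * (3 / 2) ^ n := by
    rw [volume_real_lineDomain, mul_inv, ← inv_pow, pow_succ]; norm_num; ring
  have i3 : (lineHeight n)⁻¹ * (2 * (1 / 2) ^ n) = 4 * (3 / 2) ^ n := by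
    rw [lineHeight, inv_div, inv_pow, div_inv_eq_mul]
    have : (3 / 2 : ℝ) ^ n = 3 ^ n * (1 / 2) ^ n := by rw [← mul_pow]; norm_num
    rw [this]; ring
  have key := abs_heightTraceAverage_sub_succ_le_integral h n
  rw [← mul_assoc (lineHeight n)⁻¹, i1, i2, i3] at key
  have hq : 0 ≤ (3 / 2 : ℝ) ^ n := by positivity
  rw [hpow]
  refine key.trans ?_
  calc _ ≤ 1 / 2 * (3 / 2) ^ n * (ρ * N) + 3 / 4 * (3 / 2) ^ n * (2 * ρ * N) +
        4 * (3 / 2) ^ n * (ρ * N) := by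
        gcongr
        · exact b1.trans (by gcongr)
        · exact b2.trans (by gcongr)
        · exact b0.trans (by gcongr)
    _ = _ := by ring

end

lemma exists_tendsto_of_abs_sub_le_geometric {X : Type*} [NormedAddCommGroup X] [NormedSpace ℝ X]
    {L : ℕ → X →L[ℝ] ℝ} {C r : ℝ} (hC : 0 ≤ C) (hr : 0 ≤ r) (hr1 : r < 1)
    (h : ∀ n v, |L n v - L (n + 1) v| ≤ C * r ^ n * ‖v‖) : ∃ L', Tendsto L atTop (𝓝 L') := by
  refine cauchySeq_tendsto_of_complete (cauchySeq_of_le_geometric r C hr1 fun n => ?_)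
  rw [dist_eq_norm]
  exact ContinuousLinearMap.opNorm_le_bound _ (by positivity) (h n)

lemma sqrt_two_div_two_lt_one : √2 / 2 < 1 := by
  have : √2 < 2 := by
    rw [Real.sqrt_lt' (by norm_num)]; norm_num
  linarith

lemma abs_lineForm_sub_succ_le (n : ℕ) (v : H1 biconeDomain) :
    |lineForm n v - lineForm (n + 1) v| ≤ 6 * (√2 / 2) ^ n * ‖v‖ := by
  rw [lineForm_apply, lineForm_apply]
  exact abs_heightTraceAverage_sub_succ_le (isSobolevPair_h1Rep v) (norm_nonneg v)
    (eLpNorm_h1Grad_le v) n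

lemma exists_tendsto_lineForm :
    ∃ L : H1 biconeDomain →L[ℝ] ℝ, Tendsto lineForm atTop (𝓝 L) :=
  exists_tendsto_of_abs_sub_le_geometric (X := H1 biconeDomain) (by norm_num) (by positivity)
    sqrt_two_div_two_lt_one abs_lineForm_sub_succ_le

/-- The limit of the averages over `D_n × {y_n}`. -/
def limitForm : H1 biconeDomain →L[ℝ] ℝ := exists_tendsto_lineForm.choose

lemma tendsto_lineForm : Tendsto lineForm atTop (𝓝 limitForm) := exists_tendsto_lineForm.choose_spec

/-! ## The reflection on `H¹` -/

/-- The symmetry `reflect` as a linear map. -/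
def reflectLinearMap : EuclideanSpace ℝ (Fin 2) →ₗ[ℝ] EuclideanSpace ℝ (Fin 2) where
  toFun := reflect
  map_add' x y := by ext i; fin_cases i <;> simp; ring
  map_smul' c x := by ext i; fin_cases i <;> simp

/-- The symmetry `reflect` as a linear isometry. -/
def reflectIsometry : EuclideanSpace ℝ (Fin 2) ≃ₗᵢ[ℝ] EuclideanSpace ℝ (Fin 2) where
  toLinearEquiv := LinearEquiv.ofInvolutive reflectLinearMap reflect_reflect
  norm_map' x := by
    change ‖reflect x‖ = ‖x‖
    simp [EuclideanSpace.norm_eq]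

lemma coe_reflectIsometry : ⇑reflectIsometry = reflect := rfl

lemma measurePreserving_reflect : MeasurePreserving reflect volume volume :=
  coe_reflectIsometry ▸ reflectIsometry.measurePreserving

lemma measurableEmbedding_reflect : MeasurableEmbedding reflect :=
  coe_reflectIsometry ▸ reflectIsometry.toHomeomorph.measurableEmbedding

lemma inner_reflect_left (x y : EuclideanSpace ℝ (Fin 2)) : ⟪reflect x, y⟫ = ⟪x, reflect y⟫ := by
  simp [PiLp.inner_apply]

section Reflection

variable {Ω : Set (EuclideanSpace ℝ (Fin 2))}

lemma IsTestFunction.comp_reflect {φ : EuclideanSpace ℝ (Fin 2) → ℝ} (hφ : IsTestFunction Ω φ)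
    (hΩ : reflect ⁻¹' Ω = Ω) : IsTestFunction Ω (fun x => φ (reflect x)) := by
  have hs : tsupport (fun x => φ (reflect x)) ⊆ reflect ⁻¹' tsupport φ :=
    closure_minimal (fun x hx => subset_tsupport φ hx)
      ((isClosed_tsupport φ).preimage continuous_reflect)
  refine ⟨hφ.1.comp reflectIsometry.contDiff, ?_, hs.trans ?_⟩
  · exact hφ.2.1.comp_homeomorph reflectIsometry.toHomeomorph
  · rw [← hΩ]; exact preimage_mono hφ.2.2

lemma fderiv_comp_reflect {φ : EuclideanSpace ℝ (Fin 2) → ℝ} (hφ : ContDiff ℝ ∞ φ)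
    (x v : EuclideanSpace ℝ (Fin 2)) :
    fderiv ℝ (fun x => φ (reflect x)) x v = fderiv ℝ φ (reflect x) (reflect v) := by
  have h := ((hφ.differentiable (by simp)) (reflect x)).hasFDerivAt.comp x
    (reflectIsometry.toContinuousLinearEquiv.hasFDerivAt (x := x))
  exact congrArg (fun L => L v) h.fderiv

lemma setIntegral_comp_reflect (hΩ : reflect ⁻¹' Ω = Ω) (F : EuclideanSpace ℝ (Fin 2) → ℝ) :
    ∫ x in Ω, F (reflect x) = ∫ x in Ω, F x := by
  conv_lhs => rw [← hΩ]
  exact measurePreserving_reflect.setIntegral_preimage_emb measurableEmbedding_reflect F Ω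

/-- Testing against φ ∘ ψ in the reflected direction suffices, because ψ preserves the measure, is
its own inverse and is self-adjoint. -/
lemma IsWeakGradient.comp_reflect {u : EuclideanSpace ℝ (Fin 2) → ℝ}
    {g : EuclideanSpace ℝ (Fin 2) → EuclideanSpace ℝ (Fin 2)} (h : IsWeakGradient Ω u g)
    (hΩ : reflect ⁻¹' Ω = Ω) :
    IsWeakGradient Ω (fun x => u (reflect x)) (fun x => reflect (g (reflect x))) := by
  intro φ hφ v
  have key := h _ (hφ.comp_reflect hΩ) (reflect v)
  rw [← setIntegral_comp_reflect hΩ, ← setIntegral_comp_reflect hΩ (fun x => ⟪_, _⟫ * _)] at key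
  simpa only [fderiv_comp_reflect hφ.1, reflect_reflect, inner_reflect_left] using key

lemma measurePreserving_reflect_restrict (hΩm : MeasurableSet Ω) (hΩ : reflect ⁻¹' Ω = Ω) :
    MeasurePreserving reflect (volume.restrict Ω) (volume.restrict Ω) := by
  have := measurePreserving_reflect.restrict_preimage hΩm
  rwa [hΩ] at this

lemma exists_reflect_continuousLinearMap (hΩm : MeasurableSet Ω) (hΩ : reflect ⁻¹' Ω = Ω) :
    ∃ R : H1 Ω →L[ℝ] H1 Ω, ∀ v, h1Rep (R v) =ᵐ[volume.restrict Ω] fun x => h1Rep v (reflect x) := by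
  have hmp := measurePreserving_reflect_restrict hΩm hΩ
  let A : Lp ℝ 2 (volume.restrict Ω) →L[ℝ] Lp ℝ 2 (volume.restrict Ω) :=
    (Lp.compMeasurePreservingₗᵢ ℝ reflect hmp).toContinuousLinearMap
  let B : Lp (EuclideanSpace ℝ (Fin 2)) 2 (volume.restrict Ω) →L[ℝ]
      Lp (EuclideanSpace ℝ (Fin 2)) 2 (volume.restrict Ω) :=
    ((reflectIsometry.toContinuousLinearEquiv :
      EuclideanSpace ℝ (Fin 2) →L[ℝ] EuclideanSpace ℝ (Fin 2)).compLpL 2 (volume.restrict Ω)).comp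
      (Lp.compMeasurePreservingₗᵢ ℝ reflect hmp).toContinuousLinearMap
  have hA (f) : A f =ᵐ[volume.restrict Ω] fun x => f (reflect x) :=
    Lp.coeFn_compMeasurePreserving f hmp
  have hB (f) : B f =ᵐ[volume.restrict Ω] fun x => reflect (f (reflect x)) := by
    filter_upwards [ContinuousLinearMap.coeFn_compLpL (p := 2) (μ := volume.restrict Ω)
      (reflectIsometry.toContinuousLinearEquiv :
        EuclideanSpace ℝ (Fin 2) →L[ℝ] EuclideanSpace ℝ (Fin 2))
      (Lp.compMeasurePreserving reflect hmp f), Lp.coeFn_compMeasurePreserving f hmp] with x h1 h2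
    refine h1.trans ?_
    rw [h2]
    rfl
  let e := WithLp.prodContinuousLinearEquiv 2 ℝ (Lp ℝ 2 (volume.restrict Ω))
    (Lp (EuclideanSpace ℝ (Fin 2)) 2 (volume.restrict Ω))
  let T := e.symm.toContinuousLinearMap.comp ((A.prodMap B).comp e.toContinuousLinearMap)
  refine ⟨(T.comp (H1 Ω).subtypeL).codRestrict (H1 Ω) fun v => ?_, fun v => hA v.1.fst⟩
  exact (IsWeakGradient.comp_reflect v.2 hΩ).congr (hA v.1.fst) (hB v.1.snd)

end Reflection

lemma preimage_reflect_biconeDomain : reflect ⁻¹' biconeDomain = biconeDomain := by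
  ext x
  rw [mem_preimage, mem_biconeDomain, mem_biconeDomain, reflect_zero, reflect_one, abs_neg]

/-- The map `v ↦ v ∘ ψ` on `H¹(Ω)`. -/
def reflectH1 : H1 biconeDomain →L[ℝ] H1 biconeDomain :=
  (exists_reflect_continuousLinearMap measurableSet_biconeDomain
    preimage_reflect_biconeDomain).choose

lemma h1Rep_reflectH1 (v : H1 biconeDomain) :
    h1Rep (reflectH1 v) =ᵐ[volume.restrict biconeDomain] fun x => h1Rep v (reflect x) :=
  (exists_reflect_continuousLinearMap measurableSet_biconeDomain
    preimage_reflect_biconeDomain).choose_spec v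

/-! ## Averages of continuous functions -/

/-- Neighbourhoods have positive measure; hence essential limits are unique, and traces can be
identified with point values. -/
lemma neBot_nhds_inf_ae (c : ℝ) : (𝓝 c ⊓ ae (volume : Measure ℝ)).NeBot := by
  refine inf_neBot_iff.2 fun s hs t ht => ?_
  by_contra h
  have hsub : s ⊆ tᶜ := fun x hx hxt => h ⟨x, hx, hxt⟩
  exact (Measure.measure_pos_of_mem_nhds volume hs).ne' (measure_mono_null hsub ht)

lemma IsHorizontalTrace.ae_eq_of_continuousOn {Ω : Set (EuclideanSpace ℝ (Fin 2))}
    (hΩ : IsOpen Ω) {u f : EuclideanSpace ℝ (Fin 2) → ℝ} {c : ℝ} {D : Set ℝ} {t : ℝ → ℝ}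
    (h : IsHorizontalTrace u c D t) (hDm : MeasurableSet D) (hD : ∀ x ∈ D, !₂[x, c] ∈ Ω)
    (hf : ContinuousOn f Ω) (huf : u =ᵐ[volume.restrict Ω] f) :
    ∀ᵐ x ∂volume.restrict D, t x = f !₂[x, c] := by
  have h1 : ∀ᵐ p : ℝ × ℝ, toPlane p ∈ Ω → u (toPlane p) = f (toPlane p) :=
    measurePreserving_toPlane.quasiMeasurePreserving.ae
      ((ae_restrict_iff' hΩ.measurableSet).1 huf)
  rw [Measure.volume_eq_prod] at h1
  rw [IsHorizontalTrace] at h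
  filter_upwards [h, ae_restrict_of_ae (Measure.ae_ae_of_ae_prod h1), ae_restrict_mem hDm]
    with x hx hxy hxD
  have := neBot_nhds_inf_ae c
  refine tendsto_nhds_unique hx ?_
  have hcx : Continuous fun y : ℝ => toPlane (x, y) := continuous_toPlane.comp (by fun_prop)
  have hct : Tendsto (fun y : ℝ => f (toPlane (x, y))) (𝓝 c) (𝓝 (f (toPlane (x, c)))) :=
    (hf.continuousAt (hΩ.mem_nhds (hD x hxD))).tendsto.comp hcx.continuousAt
  refine (hct.mono_left inf_le_left).congr' ?_
  filter_upwards [mem_inf_of_left ((hΩ.preimage hcx).mem_nhds (hD x hxD)), mem_inf_of_right hxy]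
    with y hy1 hy2 using (hy2 hy1).symm

lemma mk_lineHeight_mem (n : ℕ) {x : ℝ} (hx : x ∈ lineDomain n) :
    !₂[x, lineHeight n] ∈ biconeDomain := Or.inl hx

lemma mk_neg_lineHeight_mem (n : ℕ) {x : ℝ} (hx : x ∈ lineDomain n) :
    !₂[x, -lineHeight n] ∈ biconeDomain := by
  rw [← preimage_reflect_biconeDomain, mem_preimage]
  simpa [reflect] using mk_lineHeight_mem n hx

lemma lineForm_eq_of_continuousOn (n : ℕ) (v : H1 biconeDomain)
    {f : EuclideanSpace ℝ (Fin 2) → ℝ} (hf : ContinuousOn f biconeDomain)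
    (hvf : h1Rep v =ᵐ[volume.restrict biconeDomain] f) :
    IntegrableOn (fun x => f !₂[x, lineHeight n]) (lineDomain n) ∧
      lineForm n v = lineAverage n (fun x => f !₂[x, lineHeight n]) := by
  have h := (isHorizontalTrace_lineHeight n v).ae_eq_of_continuousOn isOpen_biconeDomain
    (measurableSet_lineDomain n) (fun x hx => mk_lineHeight_mem n hx) hf hvf
  refine ⟨Integrable.congr ?_ h, (lineForm_apply n v).trans (lineAverage_congr h)⟩
  have := integrableOn_heightTrace (isSobolevPair_h1Rep v) (lineHeight n)
  rwa [← lineDomain_eq] at this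

lemma lineForm_reflectH1_eq_of_continuousOn (n : ℕ) (v : H1 biconeDomain)
    {f : EuclideanSpace ℝ (Fin 2) → ℝ} (hf : ContinuousOn f biconeDomain)
    (hvf : h1Rep v =ᵐ[volume.restrict biconeDomain] f) :
    IntegrableOn (fun x => f !₂[x, -lineHeight n]) (lineDomain n) ∧
      lineForm n (reflectH1 v) = lineAverage n (fun x => f !₂[x, -lineHeight n]) := by
  have hf' : ContinuousOn (fun x => f (reflect x)) biconeDomain :=
    hf.comp continuous_reflect.continuousOn fun x hx => by
      rwa [← preimage_reflect_biconeDomain] at hx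
  have hvf' : h1Rep (reflectH1 v) =ᵐ[volume.restrict biconeDomain] fun x => f (reflect x) :=
    (h1Rep_reflectH1 v).trans ((measurePreserving_reflect_restrict measurableSet_biconeDomain
      preimage_reflect_biconeDomain).quasiMeasurePreserving.ae hvf)
  simpa [reflect] using lineForm_eq_of_continuousOn n (reflectH1 v) hf' hvf'

lemma tendsto_lineHeight : Tendsto lineHeight atTop (𝓝 0) := by
  have := (tendsto_pow_atTop_nhds_zero_of_lt_one (r := (3 : ℝ)⁻¹) (by norm_num)
    (by norm_num)).div_const 2
  rwa [zero_div] at this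

/-- The points (x, y_n) and (x, -y_n) are at distance 2y_n → 0, so uniform continuity on the compact
closure bounds the integrand uniformly in x. This is where continuity up to the boundary enters: û
is continuous on Ω itself. -/
lemma tendsto_lineAverage_sub_of_continuousOn {f : EuclideanSpace ℝ (Fin 2) → ℝ}
    (hf : ContinuousOn f (closure biconeDomain)) :
    Tendsto (fun n => lineAverage n (fun x => f !₂[x, lineHeight n] - f !₂[x, -lineHeight n]))
      atTop (𝓝 0) := by
  have huc := isBounded_biconeDomain.isCompact_closure.uniformContinuousOn_of_continuous hf
  rw [Metric.tendsto_atTop]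
  intro ε hε
  obtain ⟨δ, hδ, hδε⟩ := Metric.uniformContinuousOn_iff.1 huc (ε / 2) (by positivity)
  have hev : ∀ᶠ n in atTop, lineHeight n < δ / 2 :=
    tendsto_lineHeight.eventually (gt_mem_nhds (by positivity))
  obtain ⟨N, hN⟩ := eventually_atTop.1 hev
  refine ⟨N, fun n hn => ?_⟩
  rw [Real.dist_eq, sub_zero]
  refine lt_of_le_of_lt (abs_lineAverage_le (B := ε / 2) ?_) (by linarith)
  filter_upwards [ae_restrict_mem (measurableSet_lineDomain n)] with x hx
  have hd : dist !₂[x, lineHeight n] !₂[x, -lineHeight n] < δ := by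
    rw [EuclideanSpace.dist_eq]
    simp only [Fin.sum_univ_two, Matrix.cons_val_zero, Matrix.cons_val_one,
      Matrix.cons_val_fin_one, Real.dist_eq, sub_neg_eq_add, sub_self, abs_zero]
    have := hN n hn
    have := lineHeight_pos n
    rw [sq_abs, zero_pow two_ne_zero, zero_add, Real.sqrt_sq (by linarith)]
    linarith
  rw [← Real.dist_eq]
  exact (hδε _ (subset_closure (mk_lineHeight_mem n hx)) _
    (subset_closure (mk_neg_lineHeight_mem n hx)) hd).le

lemma tendsto_apply_of_tendsto {X : Type*} [NormedAddCommGroup X] [NormedSpace ℝ X]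
    {L : ℕ → X →L[ℝ] ℝ} {L' : X →L[ℝ] ℝ} (h : Tendsto L atTop (𝓝 L')) (v : X) :
    Tendsto (fun n => L n v) atTop (𝓝 (L' v)) :=
  ((ContinuousLinearMap.apply ℝ ℝ v).continuous.tendsto L').comp h

lemma tendsto_lineForm_apply (v : H1 biconeDomain) :
    Tendsto (fun n => lineForm n v) atTop (𝓝 (limitForm v)) :=
  tendsto_apply_of_tendsto (X := H1 biconeDomain) tendsto_lineForm v

lemma lineForm_sub_reflectH1 (n : ℕ) (v : H1 biconeDomain)
    {f : EuclideanSpace ℝ (Fin 2) → ℝ} (hf : ContinuousOn f biconeDomain)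
    (hvf : h1Rep v =ᵐ[volume.restrict biconeDomain] f) :
    lineForm n v - lineForm n (reflectH1 v) =
      lineAverage n (fun x => f !₂[x, lineHeight n] - f !₂[x, -lineHeight n]) :=
  have h1 := lineForm_eq_of_continuousOn n v hf hvf
  have h2 := lineForm_reflectH1_eq_of_continuousOn n v hf hvf
  (congrArg₂ (· - ·) h1.2 h2.2).trans (lineAverage_sub h1.1 h2.1).symm

lemma eq_of_tendsto_sub {a b c : ℕ → ℝ} {A B : ℝ} (ha : Tendsto a atTop (𝓝 A))
    (hb : Tendsto b atTop (𝓝 B)) (hc : Tendsto c atTop (𝓝 0)) (h : ∀ n, a n - b n = c n) :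
    A = B :=
  sub_eq_zero.1 (tendsto_nhds_unique (ha.sub hb) (hc.congr fun n => (h n).symm))

lemma limitForm_reflectH1_of_continuousOn (v : H1 biconeDomain)
    {f : EuclideanSpace ℝ (Fin 2) → ℝ} (hf : ContinuousOn f (closure biconeDomain))
    (hvf : h1Rep v =ᵐ[volume.restrict biconeDomain] f) :
    limitForm v = limitForm (reflectH1 v) :=
  eq_of_tendsto_sub (tendsto_lineForm_apply v) (tendsto_lineForm_apply (reflectH1 v))
    (tendsto_lineAverage_sub_of_continuousOn hf)
    fun n => lineForm_sub_reflectH1 n v (hf.mono subset_closure) hvf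

lemma eqOn_closure_of_eqOn {X : Type*} [NormedAddCommGroup X] [NormedSpace ℝ X]
    {L L' : X →L[ℝ] ℝ} {S : Set X} (h : ∀ v ∈ S, L v = L' v) {v : X} (hv : v ∈ closure S) :
    L v = L' v :=
  closure_minimal h (isClosed_eq L.continuous L'.continuous) hv

lemma limitForm_reflectH1_of_mem_H1tilde {v : H1 biconeDomain} (hv : v ∈ H1tilde biconeDomain) :
    limitForm v = limitForm (reflectH1 v) :=
  eqOn_closure_of_eqOn (X := H1 biconeDomain) (L := limitForm) (L' := limitForm.comp reflectH1)
    (fun v hv => hv.elim fun _ hf => limitForm_reflectH1_of_continuousOn v hf.1 hf.2) hv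

/-! ## The function `1` on the upper half, `-1` on the lower half -/

lemma abs_sign_le_one (r : ℝ) : |Real.sign r| ≤ 1 := by
  rcases Real.sign_apply_eq r with h | h | h <;> simp [h]

lemma measurable_real_sign : Measurable Real.sign := by
  unfold Real.sign
  exact Measurable.ite measurableSet_Iio measurable_const
    (Measurable.ite measurableSet_Ioi measurable_const measurable_const)

lemma sign_eventuallyEq {r : ℝ} (hr : r ≠ 0) : ∀ᶠ t in 𝓝 r, Real.sign t = Real.sign r := by
  rcases lt_or_gt_of_ne hr with h | h
  · filter_upwards [gt_mem_nhds h] with t ht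
    rw [Real.sign_of_neg h, Real.sign_of_neg ht]
  · filter_upwards [lt_mem_nhds h] with t ht
    rw [Real.sign_of_pos h, Real.sign_of_pos ht]

lemma sign_eq_of_ne_zero_on_Icc {h : ℝ → ℝ} (hc : Continuous h) {a b : ℝ} (hab : a ≤ b)
    (h0 : ∀ t ∈ Icc a b, h t ≠ 0) : Real.sign (h a) = Real.sign (h b) := by
  have hza := h0 a (left_mem_Icc.2 hab)
  have hzb := h0 b (right_mem_Icc.2 hab)
  rcases lt_or_gt_of_ne hza with ha | ha <;> rcases lt_or_gt_of_ne hzb with hb | hb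
  · rw [Real.sign_of_neg ha, Real.sign_of_neg hb]
  · obtain ⟨t, ht, h⟩ := intermediate_value_Icc hab hc.continuousOn ⟨ha.le, hb.le⟩
    exact absurd h (h0 t ht)
  · obtain ⟨t, ht, h⟩ := intermediate_value_Icc' hab hc.continuousOn ⟨hb.le, ha.le⟩
    exact absurd h (h0 t ht)
  · rw [Real.sign_of_pos ha, Real.sign_of_pos hb]

lemma memLp_sign_comp {α : Type*} [MeasurableSpace α] {h : α → ℝ} (hm : Measurable h)
    {μ : Measure α} [IsFiniteMeasure μ] : MemLp (fun x => Real.sign (h x)) 2 μ :=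
  MemLp.of_bound (measurable_real_sign.comp hm).aestronglyMeasurable 1
    (ae_of_all _ fun _ => abs_sign_le_one _)

/-! ### Signs of nonvanishing continuous functions -/

section Sign

variable {E : Type*} [NormedAddCommGroup E] [InnerProductSpace ℝ E] [FiniteDimensional ℝ E]
  [MeasureSpace E] [BorelSpace E] [(volume : Measure E).IsAddHaarMeasure]

lemma integral_fderiv_eq_zero_of_hasCompactSupport {φ : E → ℝ} (hφ : ContDiff ℝ ∞ φ)
    (hc : HasCompactSupport φ) (v : E) : ∫ x, fderiv ℝ φ x v = 0 := by
  have hd : Integrable fun x => fderiv ℝ φ x v :=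
    ((hφ.continuous_fderiv (by simp)).clm_apply continuous_const).integrable_of_hasCompactSupport
      (hc.fderiv_apply ℝ v)
  have := integral_mul_fderiv_eq_neg_fderiv_mul_of_integrable (μ := (volume : Measure E))
    (f := fun _ : E => (1 : ℝ)) (g := φ) (v := v) (by simp) (by simpa using hd)
    (by simpa using hφ.continuous.integrable_of_hasCompactSupport hc) (by simp)
    (fun x _ => (hφ.differentiable (by simp)) x)
  simpa using this

/-- The sign is locally constant on Ω, so its product with a test function is again smooth with
compact support, and the integral of a derivative of such a function is zero. -/
lemma isWeakGradient_sign_comp {Ω : Set E} (hΩ : IsOpen Ω) {h : E → ℝ} (hc : Continuous h)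
    (h0 : ∀ x ∈ Ω, h x ≠ 0) : IsWeakGradient Ω (fun x => Real.sign (h x)) (fun _ => 0) := by
  intro φ hφ v
  set ψ : E → ℝ := fun x => Real.sign (h x) * φ x with hψ
  have hin : ∀ x ∈ Ω, ψ =ᶠ[𝓝 x] fun z => Real.sign (h x) * φ z := by
    intro x hx
    filter_upwards [hc.continuousAt.eventually (sign_eventuallyEq (h0 x hx))] with z hz
    rw [hψ]
    simp only [hz]
  have hout : ∀ x ∉ tsupport φ, ψ =ᶠ[𝓝 x] fun _ => 0 := by
    intro x hx
    filter_upwards [(isClosed_tsupport φ).isOpen_compl.mem_nhds hx] with z hz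
    rw [hψ]
    simp only [image_eq_zero_of_notMem_tsupport hz, mul_zero]
  have hψs : ContDiff ℝ ∞ ψ := by
    rw [contDiff_iff_contDiffAt]
    intro x
    by_cases hx : x ∈ tsupport φ
    · exact (contDiffAt_const.mul hφ.1.contDiffAt).congr_of_eventuallyEq (hin x (hφ.2.2 hx))
    · exact contDiffAt_const.congr_of_eventuallyEq (hout x hx)
  have hψc : HasCompactSupport ψ := hφ.2.1.mul_left
  have hder : ∀ x ∈ Ω, fderiv ℝ ψ x v = Real.sign (h x) * fderiv ℝ φ x v := by
    intro x hx
    rw [(hin x hx).fderiv_eq, fderiv_const_mul ((hφ.1.differentiable (by simp)) x)]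
    simp
  have hnot : ∀ x ∉ Ω, fderiv ℝ ψ x v = 0 := by
    intro x hx
    rw [(hout x fun hx' => hx (hφ.2.2 hx')).fderiv_eq]
    simp
  rw [← setIntegral_congr_fun hΩ.measurableSet hder,
    setIntegral_eq_integral_of_forall_compl_eq_zero hnot,
    integral_fderiv_eq_zero_of_hasCompactSupport hψs hψc]
  simp

lemma memH1_sign_comp {Ω : Set E} (hΩ : IsOpen Ω) (hb : Bornology.IsBounded Ω) {h : E → ℝ}
    (hc : Continuous h) (h0 : ∀ x ∈ Ω, h x ≠ 0) : MemH1 Ω (fun x => Real.sign (h x)) := by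
  have : IsFiniteMeasure (volume.restrict Ω) := ⟨by simpa using hb.measure_lt_top⟩
  exact ⟨memLp_sign_comp hc.measurable, fun _ => 0, MemLp.zero', isWeakGradient_sign_comp hΩ hc h0⟩

end Sign

/-- The function equal to `1` above the horizontal axis and to `-1` below it. -/
def heightSign (z : EuclideanSpace ℝ (Fin 2)) : ℝ := Real.sign (z 1)

lemma continuous_apply_one : Continuous fun z : EuclideanSpace ℝ (Fin 2) => z 1 := by fun_prop

lemma apply_one_ne_zero {z : EuclideanSpace ℝ (Fin 2)} (hz : z ∈ biconeDomain) : z 1 ≠ 0 :=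
  abs_pos.1 (mem_biconeDomain.1 hz).1

lemma continuousOn_heightSign : ContinuousOn heightSign biconeDomain := fun _ hz =>
  ContinuousAt.continuousWithinAt (continuousAt_const.congr
    ((continuous_apply_one.continuousAt.eventually
      (sign_eventuallyEq (apply_one_ne_zero hz))).mono fun _ h => h.symm))

lemma exists_h1Rep_eq_heightSign :
    ∃ u : H1 biconeDomain, h1Rep u =ᵐ[volume.restrict biconeDomain] heightSign := by
  have := isFiniteMeasure_restrict_biconeDomain
  have hm : MemLp heightSign 2 (volume.restrict biconeDomain) :=
    memLp_sign_comp continuous_apply_one.measurable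
  refine ⟨⟨WithLp.toLp 2 (hm.toLp heightSign, 0), ?_⟩, hm.coeFn_toLp⟩
  exact (isWeakGradient_sign_comp isOpen_biconeDomain continuous_apply_one
    fun _ hz => apply_one_ne_zero hz).congr hm.coeFn_toLp (Lp.coeFn_zero _ _ _)

/-! ## The omnidirectional trace -/

/-- No measurability of the exit map is required: for a map that is not a.e. measurable,
`Measure.map` is zero by convention, and the bound is trivial. -/
lemma directionalMeasure_univ_le {d : ℕ} (Ω : Set (EuclideanSpace ℝ (Fin d)))
    (θ : EuclideanSpace ℝ (Fin d)) : directionalMeasure Ω θ univ ≤ volume Ω := by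
  rw [directionalMeasure]
  by_cases h : AEMeasurable (exitPoint Ω θ) (volume.restrict Ω)
  · rw [Measure.map_apply_of_aemeasurable h MeasurableSet.univ]; simp
  · rw [Measure.map_of_not_aemeasurable h]; simp

lemma memL2Directional_heightSign : MemL2Directional biconeDomain heightSign := by
  refine ⟨volume.real biconeDomain, fun θ _ => ?_⟩
  have hv : volume biconeDomain < ⊤ := isBounded_biconeDomain.measure_lt_top
  have hle := directionalMeasure_univ_le biconeDomain θ
  have : IsFiniteMeasure (directionalMeasure biconeDomain θ) := ⟨hle.trans_lt hv⟩
  refine ⟨memLp_sign_comp continuous_apply_one.measurable, ?_⟩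
  have h1 : ∫ z, heightSign z ^ 2 ∂(directionalMeasure biconeDomain θ) ≤
      ∫ _, (1 : ℝ) ∂(directionalMeasure biconeDomain θ) := by
    refine integral_mono_of_nonneg (ae_of_all _ fun _ => sq_nonneg _) (integrable_const _)
      (ae_of_all _ fun z => ?_)
    exact (sq_le_one_iff_abs_le_one _).2 (abs_sign_le_one _)
  refine h1.trans ?_
  rw [integral_const, smul_eq_mul, mul_one]
  exact ENNReal.toReal_mono hv.ne hle

/-- The condition that the distance of the abscissa to the Cantor set is at most the absolute height
is closed and holds on Ω; at height 0 it forces membership. -/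
lemma mem_cantorSet_of_mem_closure {z : EuclideanSpace ℝ (Fin 2)} (hz : z ∈ closure biconeDomain)
    (h1 : z 1 = 0) : z 0 ∈ cantorSet := by
  have hclosed : IsClosed {z : EuclideanSpace ℝ (Fin 2) |
      Metric.infDist (z 0) cantorSet ≤ |z 1|} :=
    isClosed_le ((Metric.continuous_infDist_pt _).comp (by fun_prop)) (by fun_prop)
  have hsub : biconeDomain ⊆ {z : EuclideanSpace ℝ (Fin 2) |
      Metric.infDist (z 0) cantorSet ≤ |z 1|} := by
    intro w hw
    obtain ⟨-, -, a, ha, haw⟩ := mem_biconeDomain.1 hw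
    exact (Metric.infDist_le_dist_of_mem ha).trans haw.le
  have hz' := closure_minimal hsub hclosed hz
  rw [mem_ofPred_eq, h1, abs_zero] at hz'
  rw [isClosed_cantorSet.mem_iff_infDist_zero ⟨0, zero_mem_cantorSet⟩]
  exact le_antisymm hz' Metric.infDist_nonneg

/-- The projection of the axis is a Lipschitz image of ℝ, and on ℝ the one-dimensional Hausdorff
measure is Lebesgue measure, for which the Cantor set is null. -/
lemma hausdorffMeasure_hyperplaneProj_cantorSet (θ : EuclideanSpace ℝ (Fin 2)) :
    Measure.hausdorffMeasure (((2 : ℕ) : ℝ) - 1)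
      (hyperplaneProj θ '' ((fun x : ℝ => !₂[x, 0]) '' cantorSet)) = 0 := by
  set w := hyperplaneProj θ !₂[1, 0] with hw
  have himage : hyperplaneProj θ '' ((fun x : ℝ => !₂[x, 0]) '' cantorSet) =
      (fun x : ℝ => x • w) '' cantorSet := by
    rw [image_image]
    congr 1
    ext1 x
    have hx : (!₂[x, 0] : EuclideanSpace ℝ (Fin 2)) = x • !₂[1, 0] := by
      ext i; fin_cases i <;> simp
    simp only [hw, hyperplaneProj]
    rw [hx, real_inner_smul_left, smul_sub, smul_smul]
  have hL : LipschitzWith ‖w‖₊ fun x : ℝ => x • w := by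
    refine LipschitzWith.of_dist_le_mul fun x y => ?_
    rw [dist_eq_norm, ← sub_smul, norm_smul, dist_eq_norm, mul_comm]
    rfl
  have hd : ((2 : ℕ) : ℝ) - 1 = 1 := by norm_num
  rw [himage, hd]
  refine le_antisymm ((hL.hausdorffMeasure_image_le zero_le_one cantorSet).trans ?_) zero_le
  rw [hausdorffMeasure_real, volume_cantorSet, mul_zero]

lemma hyperplaneProj_smul_add {θ : EuclideanSpace ℝ (Fin 2)} (hθ : ‖θ‖ = 1) (β : ℝ)
    (x : EuclideanSpace ℝ (Fin 2)) :
    hyperplaneProj θ (β • θ + hyperplaneProj θ x) = hyperplaneProj θ x := by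
  have hθ' : ⟪θ, θ⟫ = 1 := by rw [real_inner_self_eq_norm_sq, hθ, one_pow]
  have h : ⟪β • θ + hyperplaneProj θ x, θ⟫ = β := by
    simp only [hyperplaneProj, inner_add_left, inner_sub_left, real_inner_smul_left, hθ']
    ring
  rw [hyperplaneProj, h, add_sub_cancel_left]

/-- The lines through the Cantor set on the axis are discarded. On any other line, a component of
the section and its right endpoint never have height 0, so the sign is constant up to and including
that endpoint. The value 0 of `heightSign` on the axis therefore plays no role. -/
lemma isDirectionalTrace_heightSign {u : EuclideanSpace ℝ (Fin 2) → ℝ}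
    (hu : u =ᵐ[volume.restrict biconeDomain] heightSign) {θ : EuclideanSpace ℝ (Fin 2)}
    (hθ : ‖θ‖ = 1) : IsDirectionalTrace biconeDomain θ u heightSign := by
  set C : Set (EuclideanSpace ℝ (Fin 2)) := (fun x : ℝ => !₂[x, 0]) '' cantorSet with hC
  refine ⟨heightSign, hu.symm, (hyperplaneProj θ '' biconeDomain) \ (hyperplaneProj θ '' C),
    sdiff_subset, ?_, ?_⟩
  · refine measure_mono_null ?_ (hausdorffMeasure_hyperplaneProj_cantorSet θ)
    rw [sdiff_sdiff_right_self]
    exact inter_subset_right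
  rintro y ⟨⟨x, -, rfl⟩, hyC⟩
  set y := hyperplaneProj θ x with hy
  have hline : Continuous fun s : ℝ => s • θ + y := by fun_prop
  have hheight : Continuous fun s : ℝ => (s • θ + y) 1 := continuous_apply_one.comp hline
  refine ⟨?_, ?_⟩
  · refine memH1_sign_comp (isOpen_biconeDomain.preimage hline) ?_ hheight
      fun s hs => apply_one_ne_zero hs
    obtain ⟨r, hr⟩ := isBounded_biconeDomain.subset_closedBall 0
    refine isBounded_iff_forall_norm_le.2 ⟨r + ‖y‖, fun s hs => ?_⟩
    have h1 : ‖s • θ + y‖ ≤ r := by simpa using hr hs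
    calc ‖s‖ = ‖(s • θ + y) - y‖ := by rw [add_sub_cancel_right, norm_smul, hθ, mul_one]
      _ ≤ ‖s • θ + y‖ + ‖y‖ := norm_sub_le _ _
      _ ≤ _ := by linarith
  · intro α β hαβ hsub _ _
    -- The endpoint is a limit of points of Ω; at height 0 it would be a Cantor point projecting to
    -- y, against the choice of y.
    have hβ : (β • θ + y) 1 ≠ 0 := by
      intro h
      have hcl : β • θ + y ∈ closure biconeDomain := by
        have hβ' : β ∈ closure (Ioo α β) := by
          rw [closure_Ioo hαβ.ne]; exact right_mem_Icc.2 hαβ.le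
        exact map_mem_closure (f := fun s : ℝ => s • θ + y) hline hβ' hsub
      refine hyC ⟨β • θ + y, ⟨_, mem_cantorSet_of_mem_closure hcl h, ?_⟩,
        hyperplaneProj_smul_add hθ β x⟩
      ext i
      fin_cases i
      · simp
      · simpa using h.symm
    refine ⟨fun _ => heightSign (β • θ + y), continuousOn_const, ?_, rfl⟩
    filter_upwards [ae_restrict_mem measurableSet_Ioo] with s hs
    refine (sign_eq_of_ne_zero_on_Icc hheight hs.2.le fun t ht => ?_).symm
    rcases ht.2.lt_or_eq with hlt | rfl
    · exact apply_one_ne_zero (hsub ⟨hs.1.trans_le ht.1, hlt⟩)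
    · exact hβ

lemma mem_H1tr_of_eq_heightSign {u : H1 biconeDomain}
    (hu : h1Rep u =ᵐ[volume.restrict biconeDomain] heightSign) : u ∈ H1tr biconeDomain :=
  ⟨heightSign, memL2Directional_heightSign, fun _ hθ =>
    ⟨heightSign, isDirectionalTrace_heightSign hu (by simpa using hθ), EventuallyEq.rfl⟩⟩

lemma limitForm_eq_one {u : H1 biconeDomain}
    (hu : h1Rep u =ᵐ[volume.restrict biconeDomain] heightSign) : limitForm u = 1 := by
  have h (n : ℕ) : lineForm n u = 1 := by
    rw [(lineForm_eq_of_continuousOn n u continuousOn_heightSign hu).2, ← lineAverage_const n 1]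
    congr 1
    ext x
    exact Real.sign_of_pos (lineHeight_pos n)
  exact tendsto_nhds_unique (tendsto_lineForm_apply u) (by simp only [h]; exact tendsto_const_nhds)

lemma limitForm_reflectH1_eq_neg_one {u : H1 biconeDomain}
    (hu : h1Rep u =ᵐ[volume.restrict biconeDomain] heightSign) : limitForm (reflectH1 u) = -1 := by
  have h (n : ℕ) : lineForm n (reflectH1 u) = -1 := by
    rw [(lineForm_reflectH1_eq_of_continuousOn n u continuousOn_heightSign hu).2,
      ← lineAverage_const n (-1)]
    congr 1
    ext x
    exact Real.sign_of_neg (neg_neg_of_pos (lineHeight_pos n))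
  exact tendsto_nhds_unique (tendsto_lineForm_apply _) (by simp only [h]; exact tendsto_const_nhds)

lemma notMem_H1tilde_of_eq_heightSign {u : H1 biconeDomain}
    (hu : h1Rep u =ᵐ[volume.restrict biconeDomain] heightSign) : u ∉ H1tilde biconeDomain :=
  fun hmem => absurd ((limitForm_eq_one hu).symm.trans
    ((limitForm_reflectH1_of_mem_H1tilde hmem).trans (limitForm_reflectH1_eq_neg_one hu)))
    (by norm_num)

lemma limitForm_sub_apply_eq_two {u : H1 biconeDomain}
    (hu : h1Rep u =ᵐ[volume.restrict biconeDomain] heightSign) :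
    limitForm u - limitForm (reflectH1 u) = 2 :=
  (congrArg₂ (· - ·) (limitForm_eq_one hu) (limitForm_reflectH1_eq_neg_one hu)).trans (by norm_num)

lemma limitForm_sub_apply (v : H1 biconeDomain) :
    (limitForm - limitForm.comp reflectH1) v = limitForm v - limitForm (reflectH1 v) := rfl

end

theorem mainTheorem7 :
    IsOpen biconeDomain ∧ Bornology.IsBounded biconeDomain ∧
    (∃ u : H1 biconeDomain,
      -- the witness: `1` on the upper half and `-1` on the lower half
      (∀ᵐ x ∂volume.restrict biconeDomain,
        (0 < x 1 → h1Rep u x = 1) ∧ (x 1 < 0 → h1Rep u x = -1)) ∧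
      u ∈ H1tr biconeDomain \ H1tilde biconeDomain ∧
      -- the continuous linear form that separates it from the closed subspace
      ∃ (νn : ℕ → H1 biconeDomain →L[ℝ] ℝ) (ν νψ : H1 biconeDomain →L[ℝ] ℝ),
        (∀ n, IsHorizontalAverage biconeDomain (lineHeight n) (lineDomain n) (νn n)) ∧
        Tendsto νn atTop (𝓝 ν) ∧
        (∀ v : H1 biconeDomain, ∃ w : H1 biconeDomain,
          h1Rep w =ᵐ[volume.restrict biconeDomain] (fun x => h1Rep v (reflect x)) ∧ νψ v = ν w) ∧
        (∀ v ∈ H1tilde biconeDomain, (ν - νψ) v = 0) ∧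
        (ν - νψ) u = 2) := by
  exact ⟨isOpen_biconeDomain, isBounded_biconeDomain,
    exists_h1Rep_eq_heightSign.imp fun u hu =>
      ⟨hu.mono fun x hx => ⟨fun h => hx.trans (Real.sign_of_pos h),
          fun h => hx.trans (Real.sign_of_neg h)⟩,
        ⟨mem_H1tr_of_eq_heightSign hu, notMem_H1tilde_of_eq_heightSign hu⟩,
        lineForm, limitForm, limitForm.comp reflectH1, isHorizontalAverage_lineForm,
        tendsto_lineForm, fun v => ⟨reflectH1 v, h1Rep_reflectH1 v, rfl⟩,
        fun v hv => (limitForm_sub_apply v).trans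
          (sub_eq_zero.2 (limitForm_reflectH1_of_mem_H1tilde hv)),
        (limitForm_sub_apply u).trans (limitForm_sub_apply_eq_two hu)⟩⟩
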